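/- Let $R\subset\mathbb{R}^N$ be a root system, i.e. a finite set of nonzero vectors with $R\cap\mathbb{R}u=\{\pm u\}$ and $\sigma_uR=R$ for all $u\in R$, where $\sigma_u(x)=x-2\frac{\langle u,x\rangle}{|u|^2}u$. Let $W$ be the group generated by the $\sigma_u$ ($u\in R$), let $R_+=\{u\in R:\langle u,v\rangle>0\}$ for a fixed $v\in\mathbb{R}^N$ orthogonal to no root, and let $k:R\to[0,\infty)$ be $W$-invariant. Put $\omega_k(x)=\prod_{\eta\in R_+}|\langle\eta,x\rangle|^{2k(\eta)}$ and $c_k=\bigl(\int_{\mathbb{R}^N}e^{-|x|^2}\omega_k(x)\,dx\bigr)^{-1}$. For $\xi\in\mathbb{R}^N$ let $$T_\xi f(x)=\partial_\xi f(x)+\sum_{\eta\in R_+}k(\eta)\langle\eta,\xi\rangle\frac{f(x)-f(\sigma_\eta x)}{\langle\eta,x\rangle}$$ be the (commuting) Dunkl operators on polynomials, $T_i=T_{e_i}$, $\Delta_k=\sum_{i=1}^NT_i^2$, and let $[p,q]_k=\bigl(p(T_1,\dots,T_N)q\bigr)(0)$ be the Dunkl pairing of polynomials. Let $\{\varphi_\nu\}_{\nu\in\mathbb{Z}_+^N}$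 be polynomials with real coefficients, $\varphi_\nu$ homogeneous of degree $|\nu|=\nu_1+\dots+\nu_N$, that form an orthonormal basis of the space of polynomials with respect to $[\cdot,\cdot]_k$. Let $$H_\nu=2^{|\nu|}e^{-\Delta_k/4}\varphi_\nu,\qquad h_\nu(x)=\frac{\sqrt{c_k}}{2^{|\nu|/2}}e^{-|x|^2/2}H_\nu(x)$$ be the associated generalized Hermite polynomials and functions. Then for every $\alpha\in\mathbb{R}$ and every $f$ in the complex Hilbert space $L^2(\mathbb{R}^N,\omega_k(x)\,dx)$ the series $$D_k^\alpha f=\sum_{\nu\in\mathbb{Z}_+^N}e^{i|\nu|\alpha}\langle f,h_\nu\rangle h_\nu,\qquad \langle f,h_\nu\rangle=\int_{\mathbb{R}^N}f(x)\overline{h_\nu(x)}\,\omega_k(x)\,dx,$$ converges unconditionally in $L^2(\mathbb{R}^N,\omega_k(x)\,dx)$, and $\{D_k^\alpha\}_{\alpha\in\mathbb{R}}$ is a $C_0$-group of unitary operators on this space: each $D_k^\alpha$ is unitary, $D_k^0=I$, $D_k^{\alpha+\beta}=D_k^\alpha D_k^\beta$ for all $\alpha,\beta\in\mathbb{R}$,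 and $\alpha\mapsto D_k^\alpha f$ is continuous on $\mathbb{R}$ for every $f$. -/

import Mathlib

open MeasureTheory
open scoped InnerProductSpace

noncomputable section

namespace Dunkl

/-- A root system `R` in `ℝ^N` (reduced, not necessarily crystallographic or spanning), the vector
`v` outside the reflecting hyperplanes that fixes the positive subsystem, and a nonnegative
multiplicity function `k` on `R` (its values outside `R` play no role). -/
structure Datum (N : ℕ) where
  /-- the root system -/
  R : Finset (EuclideanSpace ℝ (Fin N))
  /-- the vector that determines the positive subsystem -/
  v : EuclideanSpace ℝ (Fin N)
  /-- the multiplicity function -/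
  k : EuclideanSpace ℝ (Fin N) → ℝ
  root_ne_zero : ∀ u ∈ R, u ≠ 0
  root_line : ∀ u ∈ R, (R : Set (EuclideanSpace ℝ (Fin N))) ∩ {x | ∃ t : ℝ, x = t • u} = {u, -u}
  root_reflection : ∀ u ∈ R,
    (fun x => (ℝ ∙ u)ᗮ.reflection x) '' (R : Set (EuclideanSpace ℝ (Fin N))) = R
  v_regular : ∀ u ∈ R, ⟪u, v⟫_ℝ ≠ 0
  k_nonneg : ∀ u ∈ R, 0 ≤ k u
  k_invariant : ∀ u ∈ R,
    ∀ g ∈ Subgroup.closure {s : EuclideanSpace ℝ (Fin N) ≃ₗᵢ[ℝ] EuclideanSpace ℝ (Fin N) |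
      ∃ w ∈ R, s = (ℝ ∙ w)ᗮ.reflection},
    k (g u) = k u

/-! ### Reflections and divided differences on polynomials -/

/-- The linear form `x ↦ ⟨η, x⟩` as a polynomial. -/
def linForm {N : ℕ} (η : EuclideanSpace ℝ (Fin N)) : MvPolynomial (Fin N) ℝ :=
  ∑ j, MvPolynomial.C (η j) * MvPolynomial.X j

/-- Composition `f ↦ f ∘ σ_η` of polynomials with the reflection
`σ_η x = x - 2 (⟨η, x⟩ / |η|²) η`. -/
def reflPoly {N : ℕ} (η : EuclideanSpace ℝ (Fin N)) :
    MvPolynomial (Fin N) ℝ →ₐ[ℝ] MvPolynomial (Fin N) ℝ :=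
  MvPolynomial.aeval fun i =>
    MvPolynomial.X i - MvPolynomial.C (2 * η i / ‖η‖ ^ 2) * linForm η

theorem eval_linForm {N : ℕ} (η x : EuclideanSpace ℝ (Fin N)) :
    MvPolynomial.eval (fun i => x i) (linForm η) = ⟪η, x⟫_ℝ := by
  simp [linForm, PiLp.inner_apply, mul_comm]

theorem eval_reflPoly {N : ℕ} (η x : EuclideanSpace ℝ (Fin N)) (f : MvPolynomial (Fin N) ℝ) :
    MvPolynomial.eval (fun i => x i) (reflPoly η f) =
      MvPolynomial.eval (fun i => (ℝ ∙ η)ᗮ.reflection x i) f := by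
  induction f using MvPolynomial.induction_on with
  | C a => simp [reflPoly]
  | add p q hp hq => simp [hp, hq]
  | mul_X p i hp =>
    have h : (ℝ ∙ η)ᗮ.reflection x i = x i - 2 * η i / ‖η‖ ^ 2 * ⟪η, x⟫_ℝ := by
      rw [Submodule.reflection_orthogonal_apply, Submodule.reflection_singleton_apply]
      simp only [PiLp.neg_apply, PiLp.sub_apply, PiLp.smul_apply, smul_eq_mul, nsmul_eq_mul,
        Nat.cast_ofNat, RCLike.ofReal_real_eq_id, id]
      ring
    have h2 : MvPolynomial.eval (fun i => x i) (reflPoly η (MvPolynomial.X i)) =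
        x i - 2 * η i / ‖η‖ ^ 2 * ⟪η, x⟫_ℝ := by
      simp only [reflPoly, MvPolynomial.aeval_X, map_sub, map_mul, MvPolynomial.eval_C,
        MvPolynomial.eval_X, eval_linForm]
    rw [map_mul, map_mul, map_mul, hp, h2, MvPolynomial.eval_X, h]

theorem linForm_dvd_sub {N : ℕ} (η : EuclideanSpace ℝ (Fin N)) (f : MvPolynomial (Fin N) ℝ) :
    linForm η ∣ f - reflPoly η f := by
  induction f using MvPolynomial.induction_on with
  | C a => simp [reflPoly]
  | add p q hp hq =>
    rw [map_add, add_sub_add_comm]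
    exact dvd_add hp hq
  | mul_X p i hp =>
    have h : linForm η ∣ MvPolynomial.X i - reflPoly η (MvPolynomial.X i) := by
      simp [reflPoly]
    have e : p * MvPolynomial.X i - reflPoly η (p * MvPolynomial.X i) =
        (p - reflPoly η p) * MvPolynomial.X i +
          reflPoly η p * (MvPolynomial.X i - reflPoly η (MvPolynomial.X i)) := by
      rw [map_mul]; ring
    rw [e]
    exact dvd_add (hp.mul_right _) (h.mul_left _)

theorem exists_divDiff {N : ℕ} (η : EuclideanSpace ℝ (Fin N)) :
    ∃ L : Module.End ℝ (MvPolynomial (Fin N) ℝ), ∀ f, linForm η * L f = f - reflPoly η f := by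
  choose q hq using linForm_dvd_sub η
  refine ⟨(MvPolynomial.basisMonomials (Fin N) ℝ).constr ℝ
    fun m => q (MvPolynomial.monomial m 1), fun f => ?_⟩
  have key : (LinearMap.mulLeft ℝ (linForm η)).comp
      ((MvPolynomial.basisMonomials (Fin N) ℝ).constr ℝ
        fun m => q (MvPolynomial.monomial m 1)) =
      LinearMap.id - (reflPoly η).toLinearMap := by
    refine (MvPolynomial.basisMonomials (Fin N) ℝ).ext fun m => ?_
    rw [LinearMap.comp_apply, Module.Basis.constr_basis, LinearMap.mulLeft_apply, ← hq]
    simp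
  exact LinearMap.congr_fun key f

/-- The divided difference `f ↦ (f - f ∘ σ_η) / ⟨η, ·⟩` on polynomials. For `η ≠ 0` it is
determined by `linForm_mul_divDiff`, the polynomial ring being a domain. -/
def divDiff {N : ℕ} (η : EuclideanSpace ℝ (Fin N)) : Module.End ℝ (MvPolynomial (Fin N) ℝ) :=
  (exists_divDiff η).choose

theorem linForm_mul_divDiff {N : ℕ} (η : EuclideanSpace ℝ (Fin N))
    (f : MvPolynomial (Fin N) ℝ) : linForm η * divDiff η f = f - reflPoly η f :=
  (exists_divDiff η).choose_spec f

namespace Datum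

variable {N : ℕ} (S : Datum N)

open Classical in
/-- The positive subsystem `R₊ = {u ∈ R | ⟨u, v⟩ > 0}`. -/
def posRoots : Finset (EuclideanSpace ℝ (Fin N)) := S.R.filter fun u => 0 < ⟪u, S.v⟫_ℝ

/-! ### Dunkl operators -/

/-- The Dunkl operator
`T_ξ f = ∂_ξ f + ∑_{η ∈ R₊} k(η) ⟨η, ξ⟩ (f - f ∘ σ_η) / ⟨η, ·⟩` on polynomials. -/
def dunklOp (ξ : EuclideanSpace ℝ (Fin N)) : Module.End ℝ (MvPolynomial (Fin N) ℝ) :=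
  ∑ i, ξ i • (MvPolynomial.pderiv i).toLinearMap +
    ∑ η ∈ S.posRoots, (S.k η * ⟪η, ξ⟫_ℝ) • divDiff η

/-- `T_i = T_{e_i}`. -/
def dunklOpBasis (i : Fin N) : Module.End ℝ (MvPolynomial (Fin N) ℝ) :=
  S.dunklOp (EuclideanSpace.single i 1)

/-- The operator `p(T)`, in which `T_i` is substituted for `x_i`. The `T_i` commute; the monomial
`x^m` is sent to `T_1^{m_1} ⋯ T_N^{m_N}`. -/
def polyDunkl (p : MvPolynomial (Fin N) ℝ) : Module.End ℝ (MvPolynomial (Fin N) ℝ) :=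
  ∑ m ∈ p.support, p.coeff m • (List.ofFn fun i => S.dunklOpBasis i ^ m i).prod

/-- The Dunkl pairing `[p, q]_k = (p(T) q)(0)`. -/
def pairing (p q : MvPolynomial (Fin N) ℝ) : ℝ := MvPolynomial.eval 0 (S.polyDunkl p q)

/-- The Dunkl Laplacian `Δ_k = ∑ T_i²`. -/
def laplacian : Module.End ℝ (MvPolynomial (Fin N) ℝ) := ∑ i, S.dunklOpBasis i ^ 2

/-- `e^{-Δ_k/4} p = ∑_n (-1/4)^n / n! Δ_k^n p`. Since `Δ_k` lowers the degree by two, only finitely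
many terms of the sum are nonzero. -/
def expNegLaplacian (p : MvPolynomial (Fin N) ℝ) : MvPolynomial (Fin N) ℝ :=
  ∑ᶠ n : ℕ, ((-1 / 4 : ℝ) ^ n / (n.factorial : ℝ)) • (S.laplacian ^ n) p

/-! ### The weight and generalized Hermite functions -/

/-- The weight `ω_k(x) = ∏_{η ∈ R₊} |⟨η, x⟩|^{2 k(η)}`. -/
def weight (x : EuclideanSpace ℝ (Fin N)) : ℝ := ∏ η ∈ S.posRoots, |⟪η, x⟫_ℝ| ^ (2 * S.k η)

/-- The measure `ω_k(x) dx`. -/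
def measure : Measure (EuclideanSpace ℝ (Fin N)) :=
  volume.withDensity fun x => ENNReal.ofReal (S.weight x)

/-- The constant `c_k = (∫ e^{-|x|²} ω_k(x) dx)⁻¹`. -/
def mehtaConst : ℝ :=
  (∫ x : EuclideanSpace ℝ (Fin N), Real.exp (-‖x‖ ^ 2) * S.weight x)⁻¹

/-- The complex Hilbert space `L²(ℝ^N, ω_k(x) dx)`. -/
abbrev L2 : Type := Lp ℂ 2 S.measure

/-- `φ` is an orthonormal basis of the space of polynomials with respect to the Dunkl pairing,
consisting of real polynomials, with `φ_ν` homogeneous of degree `|ν|`. -/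
structure IsHomogeneousOrthonormalBasis (φ : (Fin N → ℕ) → MvPolynomial (Fin N) ℝ) : Prop where
  homogeneous : ∀ ν, (φ ν).IsHomogeneous (∑ i, ν i)
  orthonormal : ∀ ν μ, S.pairing (φ ν) (φ μ) = if ν = μ then 1 else 0
  span_eq_top : Submodule.span ℝ (Set.range φ) = ⊤

variable (φ : (Fin N → ℕ) → MvPolynomial (Fin N) ℝ)

/-- The generalized Hermite polynomial `H_ν = 2^{|ν|} e^{-Δ_k/4} φ_ν`. -/
def hermitePoly (ν : Fin N → ℕ) : MvPolynomial (Fin N) ℝ :=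
  (2 : ℝ) ^ (∑ i, ν i) • S.expNegLaplacian (φ ν)

/-- The generalized Hermite function `h_ν(x) = √c_k 2^{-|ν|/2} e^{-|x|²/2} H_ν(x)`. -/
def hermiteFun (ν : Fin N → ℕ) (x : EuclideanSpace ℝ (Fin N)) : ℂ :=
  ((√S.mehtaConst / (2 : ℝ) ^ (((∑ i, ν i : ℕ) : ℝ) / 2) * Real.exp (-‖x‖ ^ 2 / 2) *
    MvPolynomial.eval (fun i => x i) (S.hermitePoly φ ν) : ℝ) : ℂ)

theorem poly_growth (p : MvPolynomial (Fin N) ℝ) : ∃ C c : ℝ, 0 ≤ C ∧ 0 ≤ c ∧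
    ∀ x : EuclideanSpace ℝ (Fin N),
      |MvPolynomial.eval (fun i => x i) p| ≤ C * Real.exp (c * ‖x‖) := by
  induction p using MvPolynomial.induction_on with
  | C a => exact ⟨|a|, 0, abs_nonneg _, le_rfl, fun x => by simp⟩
  | add p q hp hq =>
    obtain ⟨C, c, hC, hc, h⟩ := hp
    obtain ⟨B, b, hB, hb, h'⟩ := hq
    refine ⟨C + B, c + b, by positivity, by positivity, fun x => ?_⟩
    rw [map_add, add_mul]
    refine (abs_add_le _ _).trans (add_le_add ((h x).trans ?_) ((h' x).trans ?_))
    · gcongr; linarith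
    · gcongr; linarith
  | mul_X p i hp =>
    obtain ⟨C, c, hC, hc, h⟩ := hp
    refine ⟨C, c + 1, hC, by positivity, fun x => ?_⟩
    rw [map_mul, abs_mul, MvPolynomial.eval_X, add_mul, Real.exp_add, ← mul_assoc, one_mul]
    have h1 : |x i| ≤ ‖x‖ := by simpa using PiLp.norm_apply_le x i
    have h2 : |x i| ≤ Real.exp ‖x‖ := by linarith [Real.add_one_le_exp ‖x‖]
    exact mul_le_mul (h x) h2 (abs_nonneg _) (by positivity)

theorem weight_nonneg (x : EuclideanSpace ℝ (Fin N)) : 0 ≤ S.weight x :=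
  Finset.prod_nonneg fun _ _ => by positivity

theorem weight_continuous : Continuous S.weight := by
  refine continuous_finsetProd _ fun η hη => ?_
  have hk := S.k_nonneg η (Finset.mem_filter.1 hη).1
  exact Continuous.rpow_const (by fun_prop) fun x => Or.inr (by positivity)

theorem weight_growth : ∃ c : ℝ, 0 ≤ c ∧ ∀ x, S.weight x ≤ Real.exp (c * ‖x‖) := by
  refine ⟨∑ η ∈ S.posRoots, ‖η‖ * (2 * S.k η), Finset.sum_nonneg fun η hη => ?_, fun x => ?_⟩
  · have hk := S.k_nonneg η (Finset.mem_filter.1 hη).1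
    positivity
  · rw [Finset.sum_mul, Real.exp_sum]
    refine Finset.prod_le_prod (fun _ _ => by positivity) fun η hη => ?_
    have hk := S.k_nonneg η (Finset.mem_filter.1 hη).1
    have h1 : |⟪η, x⟫_ℝ| ≤ Real.exp (‖η‖ * ‖x‖) := by
      linarith [Real.add_one_le_exp (‖η‖ * ‖x‖), abs_real_inner_le_norm η x]
    refine (Real.rpow_le_rpow (abs_nonneg _) h1 (by positivity)).trans_eq ?_
    rw [← Real.exp_mul]
    ring_nf

theorem hermiteFun_continuous (ν : Fin N → ℕ) : Continuous (S.hermiteFun φ ν) := by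
  have h : Continuous fun x : EuclideanSpace ℝ (Fin N) =>
      MvPolynomial.eval (fun i => x i) (S.hermitePoly φ ν) :=
    (MvPolynomial.continuous_eval _).comp (by fun_prop)
  unfold hermiteFun
  fun_prop

theorem hermiteFun_memLp (ν : Fin N → ℕ) : MemLp (S.hermiteFun φ ν) 2 S.measure := by
  have hcont := S.hermiteFun_continuous φ ν
  rw [memLp_two_iff_integrable_sq_norm hcont.aestronglyMeasurable, measure,
    integrable_withDensity_iff_integrable_smul₀'
      (S.weight_continuous.measurable.ennreal_ofReal.aemeasurable)
      (Filter.Eventually.of_forall fun _ => ENNReal.ofReal_lt_top)]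
  obtain ⟨C, c, hC, hc, hp⟩ := poly_growth (S.hermitePoly φ ν)
  obtain ⟨b, hb, hw⟩ := S.weight_growth
  set A : ℝ := √S.mehtaConst / (2 : ℝ) ^ (((∑ i, ν i : ℕ) : ℝ) / 2) with hA
  have hA0 : 0 ≤ A := by positivity
  have hint : Integrable fun x : EuclideanSpace ℝ (Fin N) =>
      (A * C) ^ 2 * Real.exp ((b + 2 * c) ^ 2 / 2) * Real.exp (-(1 / 2) * ‖x‖ ^ 2) := by
    refine Integrable.const_mul ?_ _
    have h := (GaussianFourier.integrable_cexp_neg_mul_sq_norm_add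
      (V := EuclideanSpace ℝ (Fin N)) (b := (1 / 2 : ℂ)) (by norm_num) 0 0).norm
    refine h.congr (Filter.Eventually.of_forall fun x => ?_)
    simp only [zero_mul, add_zero, Complex.norm_exp]
    congr 1
    rw [show (-(1 / 2 : ℂ) * (‖x‖ : ℂ) ^ 2) = ((-(1 / 2) * ‖x‖ ^ 2 : ℝ) : ℂ) by push_cast; ring,
      Complex.ofReal_re]
  have hwc := S.weight_continuous
  refine hint.mono' ?_ (Filter.Eventually.of_forall fun x => ?_)
  · have : Continuous fun x => (ENNReal.ofReal (S.weight x)).toReal • ‖S.hermiteFun φ ν x‖ ^ 2 := by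
      simp only [ENNReal.toReal_ofReal (S.weight_nonneg _)]
      fun_prop
    exact this.aestronglyMeasurable
  · rw [ENNReal.toReal_ofReal (S.weight_nonneg _), smul_eq_mul, Real.norm_of_nonneg
      (mul_nonneg (S.weight_nonneg _) (by positivity))]
    have h1 : ‖S.hermiteFun φ ν x‖ ≤ A * Real.exp (-‖x‖ ^ 2 / 2) * (C * Real.exp (c * ‖x‖)) := by
      rw [hermiteFun, Complex.norm_real, norm_mul, ← hA,
        Real.norm_of_nonneg (mul_nonneg hA0 (Real.exp_nonneg _))]
      exact mul_le_mul_of_nonneg_left (hp x) (by positivity)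
    calc S.weight x * ‖S.hermiteFun φ ν x‖ ^ 2
        ≤ Real.exp (b * ‖x‖) *
            (A * Real.exp (-‖x‖ ^ 2 / 2) * (C * Real.exp (c * ‖x‖))) ^ 2 := by
          gcongr
          exact hw x
      _ = (A * C) ^ 2 * Real.exp (b * ‖x‖ + 2 * (-‖x‖ ^ 2 / 2) + 2 * (c * ‖x‖)) := by
          rw [Real.exp_add, Real.exp_add, two_mul (-‖x‖ ^ 2 / 2), two_mul (c * ‖x‖),
            Real.exp_add, Real.exp_add]
          ring
      _ ≤ (A * C) ^ 2 * Real.exp ((b + 2 * c) ^ 2 / 2 + -(1 / 2) * ‖x‖ ^ 2) := by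
          refine mul_le_mul_of_nonneg_left (Real.exp_le_exp.2 ?_) (by positivity)
          nlinarith [sq_nonneg (‖x‖ - (b + 2 * c))]
      _ = _ := by rw [Real.exp_add]; ring

/-- The generalized Hermite function `h_ν` as an element of `L²(ℝ^N, ω_k(x) dx)`. -/
def hermite (ν : Fin N → ℕ) : S.L2 := (S.hermiteFun_memLp φ ν).toLp _

/-- The term `e^{i|ν|α} ⟨f, h_ν⟩ h_ν` (Mathlib's inner product is conjugate-linear in its first
argument, so that `⟨f, h_ν⟩ = ∫ f \bar{h_ν} ω_k` is `inner ℂ h_ν f`). -/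
def fracDunklTerm (α : ℝ) (f : S.L2) (ν : Fin N → ℕ) : S.L2 :=
  (Complex.exp (Complex.I * ((∑ i, ν i : ℕ) : ℂ) * (α : ℂ)) * inner ℂ (S.hermite φ ν) f) •
    S.hermite φ ν

/-- The fractional Dunkl transform `D_k^α f = ∑_ν e^{i|ν|α} ⟨f, h_ν⟩ h_ν`, the (unconditional) sum
being taken in `L²(ℝ^N, ω_k(x) dx)`. -/
def fracDunkl (α : ℝ) (f : S.L2) : S.L2 := ∑' ν, S.fracDunklTerm φ α f ν

end Datum

/-- A strongly continuous one-parameter group of unitary operators on a Hilbert space. -/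
structure IsUnitaryC0Group {H : Type*} [NormedAddCommGroup H] [InnerProductSpace ℂ H]
    [CompleteSpace H] (U : ℝ → H → H) : Prop where
  unitary : ∀ α, ∃ V ∈ unitary (H →L[ℂ] H), ∀ f, U α f = V f
  zero : ∀ f, U 0 f = f
  add : ∀ α β f, U (α + β) f = U α (U β f)
  continuous : ∀ f, Continuous fun α => U α f

end Dunkl

end

/-!
The generalized Hermite functions `h_ν` form a Hilbert basis of `L²(ℝ^N, ω_k dx)`. Once this is
known, `D_k^α` is the operator that is diagonal in this basis with eigenvalues `e^{i|ν|α}` of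
modulus one, and the unconditional convergence of the series, unitarity, the group law and strong
continuity are general facts on diagonal operators (`isUnitaryC0Group_diagonal`).

*Orthonormality.* This is the Macdonald identity
`[p, q]_k = 2^n c_k ∫ e^{-Δ_k/4} p · e^{-Δ_k/4} q · e^{-|x|²} ω_k dx`, valid for `p` homogeneous of
degree `n` and any `q` (`pairing_eq_gaussForm`). In the Dunkl pairing the adjoint of the
multiplication by `x_m` is `T_m`; in the Gaussian form on the right it is `T_m / 2`
(`gaussForm_X_mul`), and both forms send `(1, q)` to `q(0)`. The adjoint in the Gaussian form comes
from two facts. The first is algebraic: `e^{-Δ_k/4} x_m = (x_m - T_m / 2) e^{-Δ_k/4}`, which follows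
from `[Δ_k, x_m] = 2 T_m` and the commutativity of the Dunkl operators. Both are derived from the
formula for `[T_ξ, x_m]` and the equivariance `σ_η T_ξ = T_{σ_η ξ} σ_η`. The second is analytic:
with respect to `e^{-|x|²} ω_k dx` the adjoint of `T_m` is `2 x_m - T_m`
(`gaussInt_dunklOpBasis_mul`). As `ω_k` need not be differentiable on the reflecting hyperplanes,
one integrates by parts against `∏ (⟨η, x⟩² + ε)^{k(η)}` instead, symmetrizes with respect to the
reflections, by which the singular factors become divided differences, and lets `ε → 0`.

*Completeness.* The intertwining relation shows that `e^{-Δ_k/4}` is surjective on polynomials, so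
that a function `g` orthogonal to all `h_ν` is orthogonal to all `p(x) e^{-|x|²/2}` with `p` a
polynomial. Summing the exponential series by dominated convergence, one finds that the Fourier
transform of the integrable function `e^{-|x|²/2} g ω_k` vanishes identically, whence `g = 0`.
-/

namespace Dunkl

open Filter Topology

variable {N : ℕ}

/-! ### Reflections -/

/-- The reflection `σ_η` in the hyperplane orthogonal to `η`. -/
noncomputable abbrev rootReflection (η : EuclideanSpace ℝ (Fin N)) :
    EuclideanSpace ℝ (Fin N) ≃ₗᵢ[ℝ] EuclideanSpace ℝ (Fin N) :=
  (ℝ ∙ η)ᗮ.reflection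

theorem rootReflection_apply (η x : EuclideanSpace ℝ (Fin N)) :
    rootReflection η x = x - (2 * ⟪η, x⟫_ℝ / ‖η‖ ^ 2) • η := by
  rw [rootReflection, Submodule.reflection_orthogonal_apply, Submodule.reflection_singleton_apply]
  simp only [RCLike.ofReal_real_eq_id, id]
  module

theorem rootReflection_rootReflection (η x : EuclideanSpace ℝ (Fin N)) :
    rootReflection η (rootReflection η x) = x :=
  Submodule.reflection_reflection _ x

theorem rootReflection_self (η : EuclideanSpace ℝ (Fin N)) : rootReflection η η = -η :=
  Submodule.reflection_orthogonalComplement_singleton_eq_neg η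

theorem rootReflection_neg (η : EuclideanSpace ℝ (Fin N)) :
    rootReflection (-η) = rootReflection η := by
  ext1 x
  simp only [rootReflection_apply, inner_neg_left, norm_neg]
  module

theorem inner_rootReflection_left (η x y : EuclideanSpace ℝ (Fin N)) :
    ⟪rootReflection η x, y⟫_ℝ = ⟪x, rootReflection η y⟫_ℝ := by
  rw [← (rootReflection η).inner_map_map x, rootReflection_rootReflection]

theorem rootReflection_conj (α η x : EuclideanSpace ℝ (Fin N)) :
    rootReflection α (rootReflection η (rootReflection α x)) =
      rootReflection (rootReflection α η) x := by
  rw [rootReflection_apply η, rootReflection_apply (rootReflection α η), map_sub, map_smul,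
    rootReflection_rootReflection, inner_rootReflection_left, LinearIsometryEquiv.norm_map]

theorem eq_of_eval_ofLp_eq {p q : MvPolynomial (Fin N) ℝ}
    (h : ∀ x : EuclideanSpace ℝ (Fin N),
      MvPolynomial.eval (fun i => x i) p = MvPolynomial.eval (fun i => x i) q) : p = q :=
  MvPolynomial.funext fun x => h (WithLp.toLp 2 x)

theorem reflPoly_reflPoly (α : EuclideanSpace ℝ (Fin N)) (f : MvPolynomial (Fin N) ℝ) :
    reflPoly α (reflPoly α f) = f :=
  eq_of_eval_ofLp_eq fun x => by rw [eval_reflPoly, eval_reflPoly, Submodule.reflection_reflection]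

theorem reflPoly_conj (α η : EuclideanSpace ℝ (Fin N)) (f : MvPolynomial (Fin N) ℝ) :
    reflPoly α (reflPoly η (reflPoly α f)) = reflPoly (rootReflection α η) f :=
  eq_of_eval_ofLp_eq fun x => by
    simp only [eval_reflPoly]
    exact congrArg (fun y : EuclideanSpace ℝ (Fin N) => MvPolynomial.eval (fun i => y i) f)
      (rootReflection_conj α η x)

theorem reflPoly_neg (η : EuclideanSpace ℝ (Fin N)) : reflPoly (-η) = reflPoly η :=
  AlgHom.ext fun f => eq_of_eval_ofLp_eq fun x => by
    rw [eval_reflPoly, eval_reflPoly]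
    exact congrArg (fun s : EuclideanSpace ℝ (Fin N) ≃ₗᵢ[ℝ] EuclideanSpace ℝ (Fin N) =>
      MvPolynomial.eval (fun i => s x i) f) (rootReflection_neg η)

theorem reflPoly_linForm (α η : EuclideanSpace ℝ (Fin N)) :
    reflPoly α (linForm η) = linForm (rootReflection α η) :=
  eq_of_eval_ofLp_eq fun x => by
    rw [eval_reflPoly, eval_linForm, eval_linForm, inner_rootReflection_left]

theorem linForm_neg (η : EuclideanSpace ℝ (Fin N)) : linForm (-η) = -linForm η :=
  eq_of_eval_ofLp_eq fun x => by rw [map_neg, eval_linForm, eval_linForm, inner_neg_left]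

theorem linForm_ne_zero {η : EuclideanSpace ℝ (Fin N)} (hη : η ≠ 0) : linForm η ≠ 0 := fun h => by
  have := eval_linForm η η
  rw [h, map_zero] at this
  exact hη (inner_self_eq_zero.1 this.symm)

theorem reflPoly_X (η : EuclideanSpace ℝ (Fin N)) (m : Fin N) :
    reflPoly η (MvPolynomial.X m) =
      MvPolynomial.X m - MvPolynomial.C (2 * η m / ‖η‖ ^ 2) * linForm η := by
  simp [reflPoly]

/-! ### Divided differences -/

theorem divDiff_eq_of_linForm_mul {η : EuclideanSpace ℝ (Fin N)} (hη : η ≠ 0)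
    {f g : MvPolynomial (Fin N) ℝ} (h : linForm η * g = f - reflPoly η f) : divDiff η f = g :=
  mul_left_cancel₀ (linForm_ne_zero hη) ((linForm_mul_divDiff η f).trans h.symm)

theorem divDiff_neg {η : EuclideanSpace ℝ (Fin N)} (hη : η ≠ 0) (f : MvPolynomial (Fin N) ℝ) :
    divDiff (-η) f = -divDiff η f :=
  divDiff_eq_of_linForm_mul (neg_ne_zero.2 hη) (by
    rw [linForm_neg, neg_mul_neg, linForm_mul_divDiff, reflPoly_neg])

theorem divDiff_C {η : EuclideanSpace ℝ (Fin N)} (hη : η ≠ 0) (a : ℝ) :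
    divDiff η (MvPolynomial.C a) = 0 :=
  divDiff_eq_of_linForm_mul hη (by simp [reflPoly])

theorem reflPoly_divDiff {α η : EuclideanSpace ℝ (Fin N)} (hη : η ≠ 0)
    (f : MvPolynomial (Fin N) ℝ) :
    reflPoly α (divDiff η f) = divDiff (rootReflection α η) (reflPoly α f) := by
  refine (divDiff_eq_of_linForm_mul (by simpa using hη) ?_).symm
  rw [← reflPoly_linForm, ← map_mul, linForm_mul_divDiff, map_sub, ← reflPoly_conj,
    reflPoly_reflPoly]

theorem divDiff_X_mul {η : EuclideanSpace ℝ (Fin N)} (hη : η ≠ 0) (m : Fin N)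
    (f : MvPolynomial (Fin N) ℝ) :
    divDiff η (MvPolynomial.X m * f) =
      MvPolynomial.X m * divDiff η f + (2 * η m / ‖η‖ ^ 2) • reflPoly η f := by
  refine divDiff_eq_of_linForm_mul hη ?_
  have h := linForm_mul_divDiff η f
  rw [map_mul, reflPoly_X, MvPolynomial.smul_eq_C_mul]
  linear_combination MvPolynomial.X m * h

/-! ### Directional derivatives -/

/-- The directional derivative `∂_ξ` on polynomials. -/
noncomputable def dirDeriv (ξ : EuclideanSpace ℝ (Fin N)) :
    Derivation ℝ (MvPolynomial (Fin N) ℝ) (MvPolynomial (Fin N) ℝ) :=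
  ∑ i, ξ i • MvPolynomial.pderiv i

theorem dirDeriv_apply (ξ : EuclideanSpace ℝ (Fin N)) (f : MvPolynomial (Fin N) ℝ) :
    dirDeriv ξ f = ∑ i, ξ i • MvPolynomial.pderiv i f := by
  change Derivation.coeFnAddMonoidHom (dirDeriv ξ) f = _
  rw [dirDeriv, map_sum, Finset.sum_apply]
  rfl

theorem dirDeriv_X (ξ : EuclideanSpace ℝ (Fin N)) (m : Fin N) :
    dirDeriv ξ (MvPolynomial.X m) = MvPolynomial.C (ξ m) := by
  classical
  rw [dirDeriv_apply, Finset.sum_eq_single m]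
  · rw [MvPolynomial.pderiv_X_self, MvPolynomial.smul_eq_C_mul, mul_one]
  · intro i _ hi
    rw [MvPolynomial.pderiv_X_of_ne hi.symm, smul_zero]
  · simp

theorem dirDeriv_C (ξ : EuclideanSpace ℝ (Fin N)) (a : ℝ) :
    dirDeriv ξ (MvPolynomial.C a) = 0 :=
  (dirDeriv ξ).map_algebraMap a

theorem dirDeriv_X_mul (ξ : EuclideanSpace ℝ (Fin N)) (m : Fin N) (f : MvPolynomial (Fin N) ℝ) :
    dirDeriv ξ (MvPolynomial.X m * f) = MvPolynomial.X m * dirDeriv ξ f + ξ m • f := by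
  rw [Derivation.leibniz, dirDeriv_X, smul_eq_mul, smul_eq_mul, MvPolynomial.smul_eq_C_mul,
    mul_comm f]

theorem dirDeriv_linForm (ξ η : EuclideanSpace ℝ (Fin N)) :
    dirDeriv ξ (linForm η) = MvPolynomial.C ⟪η, ξ⟫_ℝ := by
  simp only [linForm, map_sum, Derivation.leibniz, dirDeriv_C, dirDeriv_X,
    smul_eq_mul, PiLp.inner_apply, ← map_mul]
  refine Finset.sum_congr rfl fun i _ => ?_
  simp [mul_comm]

theorem reflPoly_dirDeriv (α ξ : EuclideanSpace ℝ (Fin N)) (f : MvPolynomial (Fin N) ℝ) :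
    reflPoly α (dirDeriv ξ f) = dirDeriv (rootReflection α ξ) (reflPoly α f) := by
  induction f using MvPolynomial.induction_on with
  | C a => rw [dirDeriv_C, map_zero, reflPoly, MvPolynomial.algHom_C, MvPolynomial.algebraMap_eq,
      dirDeriv_C]
  | add p q hp hq => simp only [map_add, hp, hq]
  | mul_X p m hp =>
    have h : reflPoly α (dirDeriv ξ (MvPolynomial.X m)) =
        dirDeriv (rootReflection α ξ) (reflPoly α (MvPolynomial.X m)) := by
      rw [dirDeriv_X, reflPoly_X, map_sub, Derivation.leibniz, dirDeriv_X, dirDeriv_C,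
        dirDeriv_linForm, reflPoly, MvPolynomial.algHom_C, MvPolynomial.algebraMap_eq, smul_zero,
        add_zero, smul_eq_mul, ← map_mul, ← map_sub, ← inner_rootReflection_left,
        rootReflection_self, rootReflection_apply, inner_neg_left]
      congr 1
      simp
      ring
    rw [Derivation.leibniz, map_mul, Derivation.leibniz, map_add, smul_eq_mul, smul_eq_mul,
      map_mul, map_mul, hp, h, smul_eq_mul, smul_eq_mul]

namespace Datum

variable (S : Datum N)

/-! ### The positive subsystem -/

theorem mem_posRoots {η : EuclideanSpace ℝ (Fin N)} :
    η ∈ S.posRoots ↔ η ∈ S.R ∧ 0 < ⟪η, S.v⟫_ℝ := by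
  classical
  simp [posRoots]

theorem ne_zero_of_mem_posRoots {η : EuclideanSpace ℝ (Fin N)} (h : η ∈ S.posRoots) : η ≠ 0 :=
  S.root_ne_zero η (S.mem_posRoots.1 h).1

theorem k_nonneg_of_mem_posRoots {η : EuclideanSpace ℝ (Fin N)} (h : η ∈ S.posRoots) :
    0 ≤ S.k η :=
  S.k_nonneg η (S.mem_posRoots.1 h).1

theorem rootReflection_mem {α η : EuclideanSpace ℝ (Fin N)} (hα : α ∈ S.R) (hη : η ∈ S.R) :
    rootReflection α η ∈ S.R := by
  have h : rootReflection α η ∈ (fun x => (ℝ ∙ α)ᗮ.reflection x) ''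
      (S.R : Set (EuclideanSpace ℝ (Fin N))) := ⟨η, hη, rfl⟩
  rwa [S.root_reflection α hα] at h

theorem neg_mem {η : EuclideanSpace ℝ (Fin N)} (hη : η ∈ S.R) : -η ∈ S.R := by
  simpa [rootReflection_self] using S.rootReflection_mem hη hη

theorem k_rootReflection {α η : EuclideanSpace ℝ (Fin N)} (hα : α ∈ S.R) (hη : η ∈ S.R) :
    S.k (rootReflection α η) = S.k η :=
  S.k_invariant η hη _ (Subgroup.subset_closure ⟨α, hα, rfl⟩)

theorem k_neg {η : EuclideanSpace ℝ (Fin N)} (hη : η ∈ S.R) : S.k (-η) = S.k η := by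
  simpa [rootReflection_self] using S.k_rootReflection hη hη

/-- A reflection permutes the positive roots up to sign, so that it does not change products of
even functions over them. -/
@[to_additive /-- A reflection permutes the positive roots up to sign, so that it does not change
sums of even functions over them. -/]
theorem prod_posRoots_rootReflection {M : Type*} [CommMonoid M]
    {α : EuclideanSpace ℝ (Fin N)} (hα : α ∈ S.R) (g : EuclideanSpace ℝ (Fin N) → M)
    (hg : ∀ η ∈ S.R, g (-η) = g η) :
    ∏ η ∈ S.posRoots, g (rootReflection α η) = ∏ η ∈ S.posRoots, g η := by
  classical
  -- the positive representative of the line spanned by the reflected root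
  let i : EuclideanSpace ℝ (Fin N) → EuclideanSpace ℝ (Fin N) := fun η =>
    if 0 < ⟪rootReflection α η, S.v⟫_ℝ then rootReflection α η else -rootReflection α η
  have hi : ∀ η ∈ S.posRoots, i η ∈ S.posRoots := fun η hη => by
    have h := S.rootReflection_mem hα (S.mem_posRoots.1 hη).1
    have h' := S.v_regular _ h
    rw [S.mem_posRoots]
    simp only [i]
    split_ifs with hc
    · exact ⟨h, hc⟩
    · rw [inner_neg_left]
      exact ⟨S.neg_mem h, neg_pos.2 (lt_of_le_of_ne (not_lt.1 hc) h')⟩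
  have hii : ∀ η ∈ S.posRoots, i (i η) = η := fun η hη => by
    have h := (S.mem_posRoots.1 hη).2
    by_cases hc : 0 < ⟪rootReflection α η, S.v⟫_ℝ
    · simp only [i, if_pos hc, rootReflection_rootReflection, if_pos h]
    · simp only [i, if_neg hc, map_neg, rootReflection_rootReflection, inner_neg_left, neg_neg,
        if_neg (not_lt.2 (neg_nonpos.2 h.le))]
  refine Finset.prod_bij' (fun η _ => i η) (fun η _ => i η) hi hi hii hii fun η hη => ?_
  simp only [i]
  split_ifs
  · rfl
  · exact (hg _ (S.rootReflection_mem hα (S.mem_posRoots.1 hη).1)).symm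

/-! ### Dunkl operators -/

theorem dunklOp_apply (ξ : EuclideanSpace ℝ (Fin N)) (f : MvPolynomial (Fin N) ℝ) :
    S.dunklOp ξ f = dirDeriv ξ f + ∑ η ∈ S.posRoots, (S.k η * ⟪η, ξ⟫_ℝ) • divDiff η f := by
  simp [dunklOp, dirDeriv_apply, LinearMap.sum_apply]

theorem dunklOp_C (ξ : EuclideanSpace ℝ (Fin N)) (a : ℝ) :
    S.dunklOp ξ (MvPolynomial.C a) = 0 := by
  rw [dunklOp_apply, dirDeriv_C, zero_add]
  exact Finset.sum_eq_zero fun η hη => by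
    rw [divDiff_C (S.ne_zero_of_mem_posRoots hη), smul_zero]

theorem dunklOp_add (ξ ζ : EuclideanSpace ℝ (Fin N)) :
    S.dunklOp (ξ + ζ) = S.dunklOp ξ + S.dunklOp ζ := by
  simp only [dunklOp, PiLp.add_apply, add_smul, inner_add_right, mul_add, Finset.sum_add_distrib]
  abel

theorem dunklOp_smul (c : ℝ) (ξ : EuclideanSpace ℝ (Fin N)) :
    S.dunklOp (c • ξ) = c • S.dunklOp ξ := by
  simp only [dunklOp, PiLp.smul_apply, smul_eq_mul, inner_smul_right, smul_add, Finset.smul_sum,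
    smul_smul, mul_left_comm]

theorem dunklOp_neg (ξ : EuclideanSpace ℝ (Fin N)) : S.dunklOp (-ξ) = -S.dunklOp ξ := by
  refine LinearMap.ext fun f => ?_
  rw [← neg_one_smul ℝ ξ, dunklOp_smul, LinearMap.smul_apply, neg_smul, one_smul,
    LinearMap.neg_apply]

theorem sum_smul_dunklOpBasis (ξ : EuclideanSpace ℝ (Fin N)) :
    ∑ i, ξ i • S.dunklOpBasis i = S.dunklOp ξ := by
  let T : EuclideanSpace ℝ (Fin N) →ₗ[ℝ] Module.End ℝ (MvPolynomial (Fin N) ℝ) :=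
    { toFun := S.dunklOp, map_add' := S.dunklOp_add, map_smul' := S.dunklOp_smul }
  have h : ∑ i, ξ i • EuclideanSpace.single i (1 : ℝ) = ξ := by
    simpa using (EuclideanSpace.basisFun (Fin N) ℝ).sum_repr ξ
  calc ∑ i, ξ i • S.dunklOpBasis i = T (∑ i, ξ i • EuclideanSpace.single i (1 : ℝ)) := by
        rw [map_sum]
        simp only [map_smul]
        rfl
    _ = S.dunklOp ξ := by rw [h]; rfl

/-- Equivariance of the Dunkl operators under the reflections: `σ_α T_ξ = T_{σ_α ξ} σ_α`. -/
theorem reflPoly_dunklOp {α : EuclideanSpace ℝ (Fin N)} (hα : α ∈ S.R)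
    (ξ : EuclideanSpace ℝ (Fin N)) (f : MvPolynomial (Fin N) ℝ) :
    reflPoly α (S.dunklOp ξ f) = S.dunklOp (rootReflection α ξ) (reflPoly α f) := by
  rw [dunklOp_apply, dunklOp_apply, map_add, reflPoly_dirDeriv, map_sum]
  congr 1
  rw [← S.sum_posRoots_rootReflection hα
    fun η => (S.k η * ⟪η, rootReflection α ξ⟫_ℝ) • divDiff η (reflPoly α f)]
  · refine Finset.sum_congr rfl fun η hη => ?_
    rw [map_smul, reflPoly_divDiff (S.ne_zero_of_mem_posRoots hη),
      S.k_rootReflection hα (S.mem_posRoots.1 hη).1, LinearIsometryEquiv.inner_map_map]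
  · intro η hη
    rw [S.k_neg hη, divDiff_neg (S.root_ne_zero η hη), inner_neg_left, mul_neg, neg_smul_neg]

/-- The commutator of a Dunkl operator with the multiplication by a coordinate is a combination of
reflections. -/
theorem dunklOp_X_mul (ξ : EuclideanSpace ℝ (Fin N)) (m : Fin N) (f : MvPolynomial (Fin N) ℝ) :
    S.dunklOp ξ (MvPolynomial.X m * f) = MvPolynomial.X m * S.dunklOp ξ f + ξ m • f +
      ∑ η ∈ S.posRoots, (S.k η * ⟪η, ξ⟫_ℝ * (2 * η m / ‖η‖ ^ 2)) • reflPoly η f := by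
  have h : ∑ η ∈ S.posRoots, (S.k η * ⟪η, ξ⟫_ℝ) • divDiff η (MvPolynomial.X m * f) =
      MvPolynomial.X m * ∑ η ∈ S.posRoots, (S.k η * ⟪η, ξ⟫_ℝ) • divDiff η f +
      ∑ η ∈ S.posRoots, (S.k η * ⟪η, ξ⟫_ℝ * (2 * η m / ‖η‖ ^ 2)) • reflPoly η f := by
    rw [Finset.mul_sum, ← Finset.sum_add_distrib]
    refine Finset.sum_congr rfl fun η hη => ?_
    rw [divDiff_X_mul (S.ne_zero_of_mem_posRoots hη), smul_add, mul_smul_comm, smul_smul]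
  rw [dunklOp_apply, dunklOp_apply, dirDeriv_X_mul, h]
  ring

/-- The Dunkl operators commute: the commutator of two of them kills the constants, and it commutes
with the multiplication by each coordinate, because `σ_η` commutes with `T_y` for
`y = ⟨η, ζ⟩ ξ - ⟨η, ξ⟩ ζ`, a vector orthogonal to `η`. -/
theorem dunklOp_comm (ξ ζ : EuclideanSpace ℝ (Fin N)) (f : MvPolynomial (Fin N) ℝ) :
    S.dunklOp ξ (S.dunklOp ζ f) = S.dunklOp ζ (S.dunklOp ξ f) := by
  induction f using MvPolynomial.induction_on with
  | C a => simp only [dunklOp_C, map_zero]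
  | add p q hp hq => simp only [map_add, hp, hq]
  | mul_X f m hf =>
    have key : ∀ η ∈ S.posRoots,
        ⟪η, ζ⟫_ℝ • S.dunklOp ξ (reflPoly η f) + ⟪η, ξ⟫_ℝ • reflPoly η (S.dunklOp ζ f) =
        ⟪η, ξ⟫_ℝ • S.dunklOp ζ (reflPoly η f) + ⟪η, ζ⟫_ℝ • reflPoly η (S.dunklOp ξ f) := by
      intro η hη
      have h := S.reflPoly_dunklOp (S.mem_posRoots.1 hη).1 (⟪η, ζ⟫_ℝ • ξ - ⟪η, ξ⟫_ℝ • ζ) f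
      have h0 : ⟪η, ⟪η, ζ⟫_ℝ • ξ - ⟪η, ξ⟫_ℝ • ζ⟫_ℝ = 0 := by
        rw [inner_sub_right, inner_smul_right, inner_smul_right]
        ring
      rw [rootReflection_apply η (_ - _), h0, mul_zero, zero_div, zero_smul, sub_zero,
        sub_eq_add_neg, ← neg_smul, dunklOp_add, dunklOp_smul, dunklOp_smul, LinearMap.add_apply,
        LinearMap.add_apply, LinearMap.smul_apply, LinearMap.smul_apply, LinearMap.smul_apply,
        LinearMap.smul_apply, map_add, map_smul, map_smul] at h
      rw [neg_smul, neg_smul] at h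
      linear_combination -h
    have hs : ∑ η ∈ S.posRoots, (S.k η * (2 * η m / ‖η‖ ^ 2)) •
          (⟪η, ζ⟫_ℝ • S.dunklOp ξ (reflPoly η f) + ⟪η, ξ⟫_ℝ • reflPoly η (S.dunklOp ζ f)) =
        ∑ η ∈ S.posRoots, (S.k η * (2 * η m / ‖η‖ ^ 2)) •
          (⟪η, ξ⟫_ℝ • S.dunklOp ζ (reflPoly η f) + ⟪η, ζ⟫_ℝ • reflPoly η (S.dunklOp ξ f)) :=
      Finset.sum_congr rfl fun η hη => by rw [key η hη]
    have expand : ∀ a b : EuclideanSpace ℝ (Fin N),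
        S.dunklOp a (S.dunklOp b (MvPolynomial.X m * f)) =
          MvPolynomial.X m * S.dunklOp a (S.dunklOp b f) + a m • S.dunklOp b f +
            b m • S.dunklOp a f +
          ∑ η ∈ S.posRoots, (S.k η * (2 * η m / ‖η‖ ^ 2)) •
            (⟪η, b⟫_ℝ • S.dunklOp a (reflPoly η f) + ⟪η, a⟫_ℝ • reflPoly η (S.dunklOp b f)) := by
      intro a b
      have e : ∑ η ∈ S.posRoots, (S.k η * (2 * η m / ‖η‖ ^ 2)) •
            (⟪η, b⟫_ℝ • S.dunklOp a (reflPoly η f) + ⟪η, a⟫_ℝ • reflPoly η (S.dunklOp b f)) =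
          ∑ η ∈ S.posRoots,
            (S.k η * ⟪η, a⟫_ℝ * (2 * η m / ‖η‖ ^ 2)) • reflPoly η (S.dunklOp b f) +
          ∑ η ∈ S.posRoots,
            (S.k η * ⟪η, b⟫_ℝ * (2 * η m / ‖η‖ ^ 2)) • S.dunklOp a (reflPoly η f) := by
        rw [← Finset.sum_add_distrib]
        refine Finset.sum_congr rfl fun η _ => ?_
        module
      rw [dunklOp_X_mul, map_add, map_add, dunklOp_X_mul, map_smul, map_sum, e]
      simp only [map_smul]
      abel
    rw [mul_comm, expand, expand, hf, hs]
    abel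

/-! ### The Dunkl Laplacian -/

theorem laplacian_apply (f : MvPolynomial (Fin N) ℝ) :
    S.laplacian f = ∑ j, S.dunklOpBasis j (S.dunklOpBasis j f) := by
  simp [laplacian, LinearMap.sum_apply, pow_two]

theorem laplacian_C (a : ℝ) : S.laplacian (MvPolynomial.C a) = 0 := by
  simp [laplacian_apply, dunklOpBasis, dunklOp_C]

theorem laplacian_dunklOpBasis (m : Fin N) (f : MvPolynomial (Fin N) ℝ) :
    S.laplacian (S.dunklOpBasis m f) = S.dunklOpBasis m (S.laplacian f) := by
  simp only [laplacian_apply, map_sum]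
  refine Finset.sum_congr rfl fun j _ => ?_
  simp only [dunklOpBasis]
  rw [S.dunklOp_comm (EuclideanSpace.single m 1), ← S.dunklOp_comm _ _ f]

/-- The commutation relation `[Δ_k, x_m] = 2 T_m`. The reflection terms cancel because
`σ_η T_η = -T_η σ_η`. -/
theorem laplacian_X_mul (m : Fin N) (f : MvPolynomial (Fin N) ℝ) :
    S.laplacian (MvPolynomial.X m * f) =
      MvPolynomial.X m * S.laplacian f + 2 • S.dunklOpBasis m f := by
  classical
  have hstep : ∀ j, S.dunklOpBasis j (S.dunklOpBasis j (MvPolynomial.X m * f)) =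
      MvPolynomial.X m * S.dunklOpBasis j (S.dunklOpBasis j f) +
        (if m = j then (2 : ℝ) else 0) • S.dunklOpBasis j f +
        ∑ η ∈ S.posRoots, (S.k η * (2 * η m / ‖η‖ ^ 2)) •
          (η j • reflPoly η (S.dunklOpBasis j f) + η j • S.dunklOpBasis j (reflPoly η f)) := by
    intro j
    have e : ∑ η ∈ S.posRoots, (S.k η * (2 * η m / ‖η‖ ^ 2)) •
          (η j • reflPoly η (S.dunklOpBasis j f) + η j • S.dunklOpBasis j (reflPoly η f)) =
        ∑ η ∈ S.posRoots, (S.k η * η j * (2 * η m / ‖η‖ ^ 2)) • reflPoly η (S.dunklOpBasis j f) +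
        ∑ η ∈ S.posRoots,
          (S.k η * η j * (2 * η m / ‖η‖ ^ 2)) • S.dunklOpBasis j (reflPoly η f) := by
      rw [← Finset.sum_add_distrib]
      refine Finset.sum_congr rfl fun η _ => ?_
      module
    have hX : ∀ g, S.dunklOpBasis j (MvPolynomial.X m * g) =
        MvPolynomial.X m * S.dunklOpBasis j g + (if m = j then (1 : ℝ) else 0) • g +
        ∑ η ∈ S.posRoots, (S.k η * η j * (2 * η m / ‖η‖ ^ 2)) • reflPoly η g := by
      intro g
      rw [dunklOpBasis, dunklOp_X_mul]
      simp [EuclideanSpace.inner_single_right]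
    rw [hX, map_add, map_add, hX, map_smul, map_sum, e]
    simp only [map_smul]
    split_ifs
    · module
    · module
  have hzero : ∀ η ∈ S.posRoots,
      ∑ j, (η j • reflPoly η (S.dunklOpBasis j f) + η j • S.dunklOpBasis j (reflPoly η f)) = 0 := by
    intro η hη
    have h1 : ∀ g, ∑ j, η j • S.dunklOpBasis j g = S.dunklOp η g := fun g => by
      rw [← S.sum_smul_dunklOpBasis η, LinearMap.sum_apply]
      rfl
    have h2 : ∑ j, η j • reflPoly η (S.dunklOpBasis j f) = reflPoly η (S.dunklOp η f) := by
      rw [← h1, map_sum]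
      simp only [map_smul]
    rw [Finset.sum_add_distrib, h2, h1, S.reflPoly_dunklOp (S.mem_posRoots.1 hη).1,
      rootReflection_self, dunklOp_neg, LinearMap.neg_apply, neg_add_cancel]
  rw [laplacian_apply, Finset.sum_congr rfl fun j _ => hstep j, Finset.sum_add_distrib,
    Finset.sum_add_distrib, Finset.sum_comm (t := S.posRoots)]
  simp only [← Finset.smul_sum]
  rw [Finset.sum_eq_zero (s := S.posRoots) fun η hη => by rw [hzero η hη, smul_zero],
    ← Finset.mul_sum, ← laplacian_apply, add_zero]
  simp [two_smul]

theorem laplacian_pow_dunklOpBasis (n : ℕ) (m : Fin N) (f : MvPolynomial (Fin N) ℝ) :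
    (S.laplacian ^ n) (S.dunklOpBasis m f) = S.dunklOpBasis m ((S.laplacian ^ n) f) := by
  induction n with
  | zero => simp
  | succ n ih => rw [pow_succ', Module.End.mul_apply, ih, laplacian_dunklOpBasis,
      Module.End.mul_apply]

theorem laplacian_pow_succ_X_mul (n : ℕ) (m : Fin N) (f : MvPolynomial (Fin N) ℝ) :
    (S.laplacian ^ (n + 1)) (MvPolynomial.X m * f) =
      MvPolynomial.X m * (S.laplacian ^ (n + 1)) f +
        (2 * (n + 1 : ℝ)) • S.dunklOpBasis m ((S.laplacian ^ n) f) := by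
  induction n with
  | zero =>
    simp only [zero_add, pow_one, pow_zero, Module.End.one_apply, laplacian_X_mul]
    module
  | succ n ih =>
    rw [pow_succ', Module.End.mul_apply, ih, map_add, laplacian_X_mul, map_smul,
      laplacian_dunklOpBasis, ← Module.End.mul_apply S.laplacian,
      ← Module.End.mul_apply S.laplacian, ← pow_succ', ← pow_succ']
    push_cast
    module

/-- The Dunkl Laplacian is locally nilpotent: if `Δ_k^M p = 0`, then `Δ_k^{M+1} (x_m p) = 0` by the
commutation relation, so that no degree count is needed. -/
theorem exists_laplacian_pow_eq_zero (f : MvPolynomial (Fin N) ℝ) :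
    ∃ M, ∀ n, M ≤ n → (S.laplacian ^ n) f = 0 := by
  suffices h : ∃ M, (S.laplacian ^ M) f = 0 by
    obtain ⟨M, hM⟩ := h
    refine ⟨M, fun n hn => ?_⟩
    obtain ⟨d, rfl⟩ := Nat.exists_eq_add_of_le hn
    rw [add_comm, pow_add, Module.End.mul_apply, hM, map_zero]
  induction f using MvPolynomial.induction_on with
  | C a => exact ⟨1, by rw [pow_one, laplacian_C]⟩
  | add p q hp hq =>
    obtain ⟨a, ha⟩ := hp
    obtain ⟨b, hb⟩ := hq
    refine ⟨a + b, ?_⟩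
    rw [map_add, pow_add, Module.End.mul_apply, Module.End.mul_apply, hb, map_zero, add_zero,
      ← Module.End.mul_apply, ← pow_add, add_comm, pow_add, Module.End.mul_apply, ha, map_zero]
  | mul_X p m hp =>
    obtain ⟨M, hM⟩ := hp
    exact ⟨M + 1, by rw [mul_comm, laplacian_pow_succ_X_mul, hM, pow_succ', Module.End.mul_apply,
      hM, map_zero, map_zero, mul_zero, smul_zero, add_zero]⟩

/-! ### The operator `e^{-Δ_k/4}` -/

theorem expNegLaplacian_eq_sum {f : MvPolynomial (Fin N) ℝ} {M : ℕ}
    (hM : ∀ n, M ≤ n → (S.laplacian ^ n) f = 0) :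
    S.expNegLaplacian f =
      ∑ n ∈ Finset.range M, ((-1 / 4 : ℝ) ^ n / (n.factorial : ℝ)) • (S.laplacian ^ n) f := by
  refine finsum_eq_sum_of_support_subset _ fun n hn => ?_
  rw [Finset.coe_range, Set.mem_Iio]
  by_contra hc
  exact hn (by simp only [hM n (not_lt.1 hc), smul_zero])

theorem expNegLaplacian_add (f g : MvPolynomial (Fin N) ℝ) :
    S.expNegLaplacian (f + g) = S.expNegLaplacian f + S.expNegLaplacian g := by
  obtain ⟨a, ha⟩ := S.exists_laplacian_pow_eq_zero f
  obtain ⟨b, hb⟩ := S.exists_laplacian_pow_eq_zero g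
  have ha' : ∀ n, max a b ≤ n → (S.laplacian ^ n) f = 0 := fun n hn =>
    ha n ((le_max_left _ _).trans hn)
  have hb' : ∀ n, max a b ≤ n → (S.laplacian ^ n) g = 0 := fun n hn =>
    hb n ((le_max_right _ _).trans hn)
  rw [S.expNegLaplacian_eq_sum ha', S.expNegLaplacian_eq_sum hb',
    S.expNegLaplacian_eq_sum (f := f + g) fun n hn => by
      rw [map_add, ha' n hn, hb' n hn, add_zero], ← Finset.sum_add_distrib]
  simp only [map_add, smul_add]

theorem expNegLaplacian_smul (c : ℝ) (f : MvPolynomial (Fin N) ℝ) :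
    S.expNegLaplacian (c • f) = c • S.expNegLaplacian f := by
  obtain ⟨a, ha⟩ := S.exists_laplacian_pow_eq_zero f
  rw [S.expNegLaplacian_eq_sum ha, S.expNegLaplacian_eq_sum (f := c • f) fun n hn => by
    rw [map_smul, ha n hn, smul_zero], Finset.smul_sum]
  simp only [map_smul, smul_comm c]

/-- `e^{-Δ_k/4}` as a linear map. -/
noncomputable def expNegLaplacianₗ : Module.End ℝ (MvPolynomial (Fin N) ℝ) where
  toFun := S.expNegLaplacian
  map_add' := S.expNegLaplacian_add
  map_smul' := S.expNegLaplacian_smul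

theorem expNegLaplacianₗ_apply (f : MvPolynomial (Fin N) ℝ) :
    S.expNegLaplacianₗ f = S.expNegLaplacian f := rfl

theorem expNegLaplacian_C (a : ℝ) :
    S.expNegLaplacian (MvPolynomial.C a) = MvPolynomial.C a := by
  rw [S.expNegLaplacian_eq_sum (M := 1)]
  · simp
  · intro n hn
    obtain ⟨d, rfl⟩ := Nat.exists_eq_add_of_le' hn
    rw [pow_succ, Module.End.mul_apply, laplacian_C, map_zero]

theorem expNegLaplacian_dunklOpBasis (m : Fin N) (f : MvPolynomial (Fin N) ℝ) :
    S.expNegLaplacian (S.dunklOpBasis m f) = S.dunklOpBasis m (S.expNegLaplacian f) := by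
  obtain ⟨a, ha⟩ := S.exists_laplacian_pow_eq_zero f
  rw [S.expNegLaplacian_eq_sum ha, S.expNegLaplacian_eq_sum (f := S.dunklOpBasis m f) fun n hn => by
    rw [laplacian_pow_dunklOpBasis, ha n hn, map_zero], map_sum]
  simp only [laplacian_pow_dunklOpBasis, map_smul]

/-- The intertwining relation `e^{-Δ_k/4} x_m = (x_m - T_m / 2) e^{-Δ_k/4}`. -/
theorem expNegLaplacian_X_mul (m : Fin N) (f : MvPolynomial (Fin N) ℝ) :
    S.expNegLaplacian (MvPolynomial.X m * f) =
      MvPolynomial.X m * S.expNegLaplacian f -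
        (1 / 2 : ℝ) • S.dunklOpBasis m (S.expNegLaplacian f) := by
  obtain ⟨M, hM⟩ := S.exists_laplacian_pow_eq_zero f
  have hX : ∀ n, M + 1 ≤ n → (S.laplacian ^ n) (MvPolynomial.X m * f) = 0 := by
    intro n hn
    obtain ⟨d, rfl⟩ := Nat.exists_eq_add_of_le' (Nat.le_trans (Nat.le_add_left 1 M) hn)
    rw [laplacian_pow_succ_X_mul, hM d (by omega), hM (d + 1) (by omega), map_zero, mul_zero,
      smul_zero, add_zero]
  have hM' : ∀ n, M + 1 ≤ n → (S.laplacian ^ n) f = 0 := fun n hn => hM n (by omega)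
  have h1 := S.expNegLaplacian_eq_sum hM'
  have h2 := S.expNegLaplacian_eq_sum hM
  rw [Finset.sum_range_succ'] at h1
  rw [S.expNegLaplacian_eq_sum hX, Finset.sum_range_succ']
  rw [show MvPolynomial.X m * S.expNegLaplacian f = MvPolynomial.X m * _ from
    congrArg _ h1, h2]
  simp only [laplacian_pow_succ_X_mul, map_sum, map_smul, mul_add (MvPolynomial.X m),
    Finset.mul_sum, smul_add,
    Finset.sum_add_distrib, Finset.smul_sum, mul_smul_comm, pow_zero, Module.End.one_apply]
  have h3 : ∑ n ∈ Finset.range M, ((-1 / 4 : ℝ) ^ (n + 1) / ((n + 1).factorial : ℝ)) •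
        (2 * (n + 1 : ℝ)) • S.dunklOpBasis m ((S.laplacian ^ n) f) =
      -∑ n ∈ Finset.range M, (1 / 2 : ℝ) • ((-1 / 4 : ℝ) ^ n / (n.factorial : ℝ)) •
        S.dunklOpBasis m ((S.laplacian ^ n) f) := by
    rw [← Finset.sum_neg_distrib]
    refine Finset.sum_congr rfl fun n _ => ?_
    rw [smul_smul, smul_smul, ← neg_smul]
    congr 1
    rw [Nat.factorial_succ, pow_succ]
    have : (n.factorial : ℝ) ≠ 0 := by positivity
    have : (n : ℝ) + 1 ≠ 0 := by positivity
    push_cast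
    field_simp
    ring
  rw [h3]
  abel

/-- The range of `e^{-Δ_k/4}` contains the constants, and by the intertwining relation it is stable
under the multiplication by coordinates. -/
theorem expNegLaplacian_surjective : Function.Surjective S.expNegLaplacian := by
  intro f
  change ∃ a, S.expNegLaplacianₗ a = f
  rw [← LinearMap.mem_range]
  induction f using MvPolynomial.induction_on with
  | C a => exact ⟨_, S.expNegLaplacian_C a⟩
  | add p q hp hq => exact add_mem hp hq
  | mul_X p m hp =>
    obtain ⟨g, rfl⟩ := hp
    refine ⟨MvPolynomial.X m * g + (1 / 2 : ℝ) • S.dunklOpBasis m g, ?_⟩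
    simp only [expNegLaplacianₗ_apply, expNegLaplacian_add, expNegLaplacian_smul,
      expNegLaplacian_dunklOpBasis, expNegLaplacian_X_mul]
    ring

end Datum

/-! ### Functions of exponential growth -/

/-- Functions on `ℝ^N` of at most exponential growth. -/
def ExpBounded (f : EuclideanSpace ℝ (Fin N) → ℝ) : Prop :=
  ∃ C c : ℝ, 0 ≤ C ∧ 0 ≤ c ∧ ∀ x, |f x| ≤ C * Real.exp (c * ‖x‖)

theorem ExpBounded.mono {f g : EuclideanSpace ℝ (Fin N) → ℝ} (hg : ExpBounded g)
    (h : ∀ x, |f x| ≤ |g x|) : ExpBounded f := by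
  obtain ⟨C, c, hC, hc, hb⟩ := hg
  exact ⟨C, c, hC, hc, fun x => (h x).trans (hb x)⟩

theorem ExpBounded.mul {f g : EuclideanSpace ℝ (Fin N) → ℝ} (hf : ExpBounded f)
    (hg : ExpBounded g) : ExpBounded fun x => f x * g x := by
  obtain ⟨C, c, hC, hc, h⟩ := hf
  obtain ⟨B, b, hB, hb, h'⟩ := hg
  refine ⟨C * B, c + b, by positivity, by positivity, fun x => ?_⟩
  rw [abs_mul, add_mul, Real.exp_add, mul_mul_mul_comm]
  exact mul_le_mul (h x) (h' x) (abs_nonneg _) (by positivity)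

theorem expBounded_const (a : ℝ) : ExpBounded fun _ : EuclideanSpace ℝ (Fin N) => a :=
  ⟨|a|, 0, abs_nonneg _, le_rfl, fun x => by simp⟩

theorem expBounded_eval (p : MvPolynomial (Fin N) ℝ) :
    ExpBounded fun x : EuclideanSpace ℝ (Fin N) => MvPolynomial.eval (fun i => x i) p :=
  Datum.poly_growth p

theorem continuous_eval_ofLp (p : MvPolynomial (Fin N) ℝ) :
    Continuous fun x : EuclideanSpace ℝ (Fin N) => MvPolynomial.eval (fun i => x i) p :=
  (MvPolynomial.continuous_eval _).comp (by fun_prop)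

theorem integrable_exp_neg_sq {a : ℝ} (ha : 0 < a) :
    Integrable fun x : EuclideanSpace ℝ (Fin N) => Real.exp (-a * ‖x‖ ^ 2) := by
  have h := (GaussianFourier.integrable_cexp_neg_mul_sq_norm_add
    (V := EuclideanSpace ℝ (Fin N)) (b := (a : ℂ)) (by simpa using ha) 0 0).norm
  refine h.congr (Eventually.of_forall fun x => ?_)
  simp only [zero_mul, add_zero, Complex.norm_exp]
  congr 1
  rw [show (-(a : ℂ) * (‖x‖ : ℂ) ^ 2) = ((-a * ‖x‖ ^ 2 : ℝ) : ℂ) by push_cast; ring,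
    Complex.ofReal_re]

theorem ExpBounded.integrable_mul_exp {f : EuclideanSpace ℝ (Fin N) → ℝ} (hf : ExpBounded f)
    (hm : AEStronglyMeasurable f volume) :
    Integrable fun x => f x * Real.exp (-‖x‖ ^ 2) := by
  obtain ⟨C, c, hC, hc, h⟩ := hf
  refine ((integrable_exp_neg_sq (N := N) (a := 1 / 2) (by norm_num)).const_mul
    (C * Real.exp (c ^ 2 / 2))).mono' ?_ (Eventually.of_forall fun x => ?_)
  · exact hm.mul (by fun_prop : Continuous fun x : EuclideanSpace ℝ (Fin N) =>
      Real.exp (-‖x‖ ^ 2)).aestronglyMeasurable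
  · rw [norm_mul, Real.norm_eq_abs, Real.norm_of_nonneg (Real.exp_nonneg _)]
    calc |f x| * Real.exp (-‖x‖ ^ 2) ≤ C * Real.exp (c * ‖x‖) * Real.exp (-‖x‖ ^ 2) := by
          gcongr
          exact h x
      _ = C * Real.exp (c * ‖x‖ + -‖x‖ ^ 2) := by rw [Real.exp_add]; ring
      _ ≤ C * Real.exp (c ^ 2 / 2 + -(1 / 2) * ‖x‖ ^ 2) := by
          gcongr C * Real.exp ?_
          nlinarith [sq_nonneg (‖x‖ - c)]
      _ = _ := by rw [Real.exp_add]; ring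

/-! ### Directional derivatives of polynomial functions -/

theorem hasLineDerivAt_eval (p : MvPolynomial (Fin N) ℝ) (x ξ : EuclideanSpace ℝ (Fin N)) :
    HasLineDerivAt ℝ (fun y : EuclideanSpace ℝ (Fin N) => MvPolynomial.eval (fun i => y i) p)
      (MvPolynomial.eval (fun i => x i) (dirDeriv ξ p)) x ξ := by
  induction p using MvPolynomial.induction_on with
  | C a =>
    simp only [dirDeriv_C, map_zero, MvPolynomial.eval_C]
    exact hasDerivAt_const _ _
  | add p q hp hq =>
    simp only [map_add]
    exact HasDerivAt.add hp hq
  | mul_X p m hp =>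
    have h : HasDerivAt (fun t : ℝ => (x + t • ξ) m) (ξ m) 0 := by
      simpa using ((hasDerivAt_id (0 : ℝ)).mul_const (ξ m)).const_add (x m)
    have h2 := HasDerivAt.mul hp h
    have e : dirDeriv ξ (p * MvPolynomial.X m) = dirDeriv ξ p * MvPolynomial.X m + ξ m • p := by
      rw [mul_comm, dirDeriv_X_mul, mul_comm]
    simp only [HasLineDerivAt, e, map_mul, map_add, MvPolynomial.eval_X, MvPolynomial.smul_eval]
    refine h2.congr_deriv ?_
    simp only [zero_smul, add_zero]
    ring

namespace Datum

variable (S : Datum N)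

/-! ### The regularized weight -/

theorem weight_rootReflection {α : EuclideanSpace ℝ (Fin N)} (hα : α ∈ S.R)
    (x : EuclideanSpace ℝ (Fin N)) : S.weight (rootReflection α x) = S.weight x := by
  rw [weight, weight, ← S.prod_posRoots_rootReflection hα fun η => |⟪η, x⟫_ℝ| ^ (2 * S.k η)]
  · refine Finset.prod_congr rfl fun η hη => ?_
    rw [S.k_rootReflection hα (S.mem_posRoots.1 hη).1, inner_rootReflection_left]
  · intro η hη
    rw [S.k_neg hη, inner_neg_left, abs_neg]

/-- The smooth positive function `∏_{η ∈ R₊} (⟨η, x⟩² + ε)^{k(η)}`, which tends to the weight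
as `ε → 0`. -/
noncomputable def regWeight (ε : ℝ) (x : EuclideanSpace ℝ (Fin N)) : ℝ :=
  ∏ η ∈ S.posRoots, (⟪η, x⟫_ℝ ^ 2 + ε) ^ S.k η

theorem regWeight_pos {ε : ℝ} (hε : 0 < ε) (x : EuclideanSpace ℝ (Fin N)) :
    0 < S.regWeight ε x :=
  Finset.prod_pos fun _ _ => by positivity

theorem regWeight_rootReflection {α : EuclideanSpace ℝ (Fin N)} (hα : α ∈ S.R) (ε : ℝ)
    (x : EuclideanSpace ℝ (Fin N)) :
    S.regWeight ε (rootReflection α x) = S.regWeight ε x := by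
  rw [regWeight, regWeight,
    ← S.prod_posRoots_rootReflection hα fun η => (⟪η, x⟫_ℝ ^ 2 + ε) ^ S.k η]
  · refine Finset.prod_congr rfl fun η hη => ?_
    rw [S.k_rootReflection hα (S.mem_posRoots.1 hη).1, inner_rootReflection_left]
  · intro η hη
    rw [S.k_neg hη, inner_neg_left, neg_sq]

theorem regWeight_zero (x : EuclideanSpace ℝ (Fin N)) : S.regWeight 0 x = S.weight x := by
  refine Finset.prod_congr rfl fun η _ => ?_
  rw [add_zero, Real.rpow_mul (abs_nonneg _), Real.rpow_two, sq_abs]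

theorem continuous_regWeight : Continuous fun p : ℝ × EuclideanSpace ℝ (Fin N) =>
    S.regWeight p.1 p.2 := by
  refine continuous_finsetProd _ fun η hη => ?_
  exact Continuous.rpow_const (by fun_prop) fun x => Or.inr (S.k_nonneg_of_mem_posRoots hη)

theorem continuous_regWeight_right (ε : ℝ) : Continuous fun x => S.regWeight ε x := by
  simpa only [Function.comp_def] using S.continuous_regWeight.comp (Continuous.prodMk_right ε)

theorem regWeight_mono {ε δ : ℝ} (hε : 0 ≤ ε) (h : ε ≤ δ) (x : EuclideanSpace ℝ (Fin N)) :
    S.regWeight ε x ≤ S.regWeight δ x := by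
  refine Finset.prod_le_prod (fun _ _ => by positivity) fun η hη => ?_
  exact Real.rpow_le_rpow (by positivity) (by linarith) (S.k_nonneg_of_mem_posRoots hη)

theorem expBounded_regWeight_one : ExpBounded (S.regWeight 1) := by
  refine ⟨1, ∑ η ∈ S.posRoots, ‖η‖ * (2 * S.k η), zero_le_one, Finset.sum_nonneg fun η hη => ?_,
    fun x => ?_⟩
  · have hk := S.k_nonneg_of_mem_posRoots hη
    positivity
  · rw [abs_of_pos (S.regWeight_pos one_pos x), one_mul, Finset.sum_mul, Real.exp_sum]
    refine Finset.prod_le_prod (fun _ _ => by positivity) fun η hη => ?_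
    have hk := S.k_nonneg_of_mem_posRoots hη
    have h1 : ⟪η, x⟫_ℝ ^ 2 + 1 ≤ Real.exp (‖η‖ * ‖x‖ * 2) := by
      have h2 := abs_real_inner_le_norm η x
      have h3 := Real.add_one_le_exp (‖η‖ * ‖x‖)
      have h4 : (‖η‖ * ‖x‖ + 1) ^ 2 ≤ Real.exp (‖η‖ * ‖x‖) ^ 2 := by gcongr
      have h5 : ⟪η, x⟫_ℝ ^ 2 ≤ (‖η‖ * ‖x‖) ^ 2 := by
        rw [← sq_abs]
        gcongr
      rw [Real.exp_mul, Real.rpow_two]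
      nlinarith [mul_nonneg (norm_nonneg η) (norm_nonneg x)]
    refine (Real.rpow_le_rpow (by positivity) h1 hk).trans_eq ?_
    rw [← Real.exp_mul]
    ring_nf

theorem expBounded_regWeight {ε : ℝ} (hε : 0 ≤ ε) (hε1 : ε ≤ 1) : ExpBounded (S.regWeight ε) :=
  S.expBounded_regWeight_one.mono fun x => by
    have h0 : 0 ≤ S.regWeight ε x := Finset.prod_nonneg fun _ _ => by positivity
    rw [abs_of_nonneg h0, abs_of_pos (S.regWeight_pos one_pos x)]
    exact S.regWeight_mono hε hε1 x

theorem regWeight_eq_exp {ε : ℝ} (hε : 0 < ε) (x : EuclideanSpace ℝ (Fin N)) :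
    S.regWeight ε x = Real.exp (∑ η ∈ S.posRoots, Real.log (⟪η, x⟫_ℝ ^ 2 + ε) * S.k η) := by
  rw [Real.exp_sum]
  exact Finset.prod_congr rfl fun η _ => Real.rpow_def_of_pos (by positivity) _

theorem hasLineDerivAt_exp_mul_regWeight {ε : ℝ} (hε : 0 < ε) (x ξ : EuclideanSpace ℝ (Fin N)) :
    HasLineDerivAt ℝ (fun y => Real.exp (-‖y‖ ^ 2) * S.regWeight ε y)
      ((Real.exp (-‖x‖ ^ 2) * S.regWeight ε x) * (-(2 * ⟪ξ, x⟫_ℝ) +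
        ∑ η ∈ S.posRoots, 2 * (S.k η * ⟪η, ξ⟫_ℝ) * (⟪η, x⟫_ℝ / (⟪η, x⟫_ℝ ^ 2 + ε)))) x ξ := by
  have e : (fun y => Real.exp (-‖y‖ ^ 2) * S.regWeight ε y) = fun y => Real.exp (-‖y‖ ^ 2 +
      ∑ η ∈ S.posRoots, Real.log (⟪η, y⟫_ℝ ^ 2 + ε) * S.k η) := by
    ext y
    rw [Real.exp_add, S.regWeight_eq_exp hε]
  have e' := congrFun e x
  rw [e', e]
  have hl : HasDerivAt (fun t : ℝ => x + t • ξ) ξ 0 := by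
    simpa using ((hasDerivAt_id (0 : ℝ)).smul_const ξ).const_add x
  have hn : HasDerivAt (fun t : ℝ => -‖x + t • ξ‖ ^ 2) (-(2 * ⟪ξ, x⟫_ℝ)) 0 := by
    simpa [real_inner_comm] using hl.norm_sq.fun_neg
  have hs : ∀ η ∈ S.posRoots, HasDerivAt
      (fun t : ℝ => Real.log (⟪η, x + t • ξ⟫_ℝ ^ 2 + ε) * S.k η)
      (2 * (S.k η * ⟪η, ξ⟫_ℝ) * (⟪η, x⟫_ℝ / (⟪η, x⟫_ℝ ^ 2 + ε))) 0 := by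
    intro η _
    have h1 : HasDerivAt (fun t : ℝ => ⟪η, x + t • ξ⟫_ℝ) ⟪η, ξ⟫_ℝ 0 := by
      simpa using (hasDerivAt_const (0 : ℝ) η).inner ℝ hl
    have h2 := (((h1.pow 2).add_const ε).log
      (ne_of_gt (add_pos_of_nonneg_of_pos (sq_nonneg _) hε))).mul_const (S.k η)
    refine h2.congr_deriv ?_
    simp only [Pi.pow_apply, zero_smul, add_zero]
    push_cast
    ring
  have h := (hn.add (HasDerivAt.fun_sum hs)).exp
  simpa [HasLineDerivAt] using h

/-! ### Integration by parts -/

theorem integrable_reg {f : EuclideanSpace ℝ (Fin N) → ℝ} (hf : ExpBounded f)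
    (hc : Continuous f) {ε : ℝ} (hε : 0 ≤ ε) (hε1 : ε ≤ 1) :
    Integrable fun x => f x * (Real.exp (-‖x‖ ^ 2) * S.regWeight ε x) := by
  have hw := S.continuous_regWeight_right ε
  have hm : Continuous fun x => f x * S.regWeight ε x := hc.mul hw
  have h := (hf.mul (S.expBounded_regWeight hε hε1)).integrable_mul_exp hm.aestronglyMeasurable
  simpa only [mul_assoc, mul_comm (S.regWeight ε _)] using h

/-- The factor `⟨η, x⟩ / (⟨η, x⟩² + ε)` regularizes `1 / ⟨η, x⟩`. -/
theorem expBounded_div (η : EuclideanSpace ℝ (Fin N)) {ε : ℝ} (hε : 0 < ε) :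
    ExpBounded fun x => ⟪η, x⟫_ℝ / (⟪η, x⟫_ℝ ^ 2 + ε) := by
  refine ((expBounded_eval (linForm η)).mul (expBounded_const (1 / ε))).mono fun x => ?_
  rw [eval_linForm, abs_mul, abs_div, div_eq_mul_one_div, abs_of_pos (by positivity : 0 < 1 / ε),
    abs_of_pos (by positivity : 0 < ⟪η, x⟫_ℝ ^ 2 + ε)]
  gcongr
  nlinarith [sq_nonneg ⟪η, x⟫_ℝ]

theorem continuous_div (η : EuclideanSpace ℝ (Fin N)) {ε : ℝ} (hε : 0 < ε) :
    Continuous fun x : EuclideanSpace ℝ (Fin N) => ⟪η, x⟫_ℝ / (⟪η, x⟫_ℝ ^ 2 + ε) :=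
  Continuous.div (by fun_prop) (by fun_prop) fun x => by positivity

theorem integrable_eval_mul_div (p : MvPolynomial (Fin N) ℝ) (η : EuclideanSpace ℝ (Fin N))
    {ε : ℝ} (hε : 0 < ε) (hε1 : ε ≤ 1) :
    Integrable fun x : EuclideanSpace ℝ (Fin N) => MvPolynomial.eval (fun i => x i) p *
      (⟪η, x⟫_ℝ / (⟪η, x⟫_ℝ ^ 2 + ε)) * (Real.exp (-‖x‖ ^ 2) * S.regWeight ε x) :=
  S.integrable_reg ((expBounded_eval p).mul (expBounded_div η hε))
    ((continuous_eval_ofLp p).mul (continuous_div η hε)) hε.le hε1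

/-- Integration by parts against the regularized weight. -/
theorem integral_dirDeriv_reg (p : MvPolynomial (Fin N) ℝ) (ξ : EuclideanSpace ℝ (Fin N))
    {ε : ℝ} (hε : 0 < ε) (hε1 : ε ≤ 1) :
    ∫ x : EuclideanSpace ℝ (Fin N), MvPolynomial.eval (fun i => x i)
        (dirDeriv ξ p - 2 • (linForm ξ * p)) * (Real.exp (-‖x‖ ^ 2) * S.regWeight ε x) =
      -∑ η ∈ S.posRoots, S.k η * ⟪η, ξ⟫_ℝ * (2 * ∫ x : EuclideanSpace ℝ (Fin N),
        MvPolynomial.eval (fun i => x i) p * (⟪η, x⟫_ℝ / (⟪η, x⟫_ℝ ^ 2 + ε)) *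
          (Real.exp (-‖x‖ ^ 2) * S.regWeight ε x)) := by
  set M : EuclideanSpace ℝ (Fin N) → ℝ := fun x => Real.exp (-‖x‖ ^ 2) * S.regWeight ε x with hM
  have hp := fun q => S.integrable_reg (expBounded_eval q) (continuous_eval_ofLp q) hε.le hε1
  have hd := fun η => S.integrable_eval_mul_div p η hε hε1
  have hsum : Integrable fun x : EuclideanSpace ℝ (Fin N) => ∑ η ∈ S.posRoots,
      S.k η * ⟪η, ξ⟫_ℝ * (2 * (MvPolynomial.eval (fun i => x i) p *
        (⟪η, x⟫_ℝ / (⟪η, x⟫_ℝ ^ 2 + ε)) * M x)) :=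
    integrable_finsetSum _ fun η _ => ((hd η).const_mul 2).const_mul _
  have e : ∀ x : EuclideanSpace ℝ (Fin N), MvPolynomial.eval (fun i => x i) p *
      (M x * (-(2 * ⟪ξ, x⟫_ℝ) +
        ∑ η ∈ S.posRoots, 2 * (S.k η * ⟪η, ξ⟫_ℝ) * (⟪η, x⟫_ℝ / (⟪η, x⟫_ℝ ^ 2 + ε)))) =
      -(MvPolynomial.eval (fun i => x i) (2 • (linForm ξ * p)) * M x) +
      ∑ η ∈ S.posRoots, S.k η * ⟪η, ξ⟫_ℝ * (2 * (MvPolynomial.eval (fun i => x i) p *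
        (⟪η, x⟫_ℝ / (⟪η, x⟫_ℝ ^ 2 + ε)) * M x)) := by
    intro x
    rw [two_smul, map_add, map_mul, eval_linForm, mul_add, mul_add, Finset.mul_sum,
      Finset.mul_sum]
    congr 1
    · ring
    · exact Finset.sum_congr rfl fun η _ => by ring
  have hMd : ∀ x, HasLineDerivAt ℝ M (M x * (-(2 * ⟪ξ, x⟫_ℝ) +
      ∑ η ∈ S.posRoots, 2 * (S.k η * ⟪η, ξ⟫_ℝ) * (⟪η, x⟫_ℝ / (⟪η, x⟫_ℝ ^ 2 + ε)))) x ξ :=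
    fun x => S.hasLineDerivAt_exp_mul_regWeight hε x ξ
  have key := integral_bilinear_hasLineDerivAt_right_eq_neg_left_of_integrable
    (μ := (volume : Measure (EuclideanSpace ℝ (Fin N)))) (B := ContinuousLinearMap.mul ℝ ℝ)
    (f := fun x : EuclideanSpace ℝ (Fin N) => MvPolynomial.eval (fun i => x i) p) (g := M)
    (v := ξ) (hp (dirDeriv ξ p))
    (by
      simp only [ContinuousLinearMap.mul_apply']
      simp only [e]
      exact (hp _).neg.add hsum)
    (hp p) (fun x _ => hasLineDerivAt_eval p x ξ)
    (fun x _ => hMd x)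
  simp only [ContinuousLinearMap.mul_apply'] at key
  simp only [e] at key
  have hneg : Integrable fun x : EuclideanSpace ℝ (Fin N) =>
      -(MvPolynomial.eval (fun i => x i) (2 • (linForm ξ * p)) * M x) := (hp _).neg
  rw [integral_add hneg hsum, integral_neg, integral_finsetSum _ fun η _ =>
    ((hd η).const_mul 2).const_mul _] at key
  simp only [integral_const_mul] at key
  simp only [map_sub, sub_mul]
  rw [integral_sub (hp _) (hp _)]
  linarith

/-- Symmetrization with respect to the reflection `σ_η` turns the singular factor
`1 / ⟨η, x⟩` into a divided difference. -/
theorem integral_symm_reg (p : MvPolynomial (Fin N) ℝ) {η : EuclideanSpace ℝ (Fin N)}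
    (hη : η ∈ S.R) {ε : ℝ} (hε : 0 < ε) (hε1 : ε ≤ 1) :
    2 * ∫ x : EuclideanSpace ℝ (Fin N),
        MvPolynomial.eval (fun i => x i) p * (⟪η, x⟫_ℝ / (⟪η, x⟫_ℝ ^ 2 + ε)) *
          (Real.exp (-‖x‖ ^ 2) * S.regWeight ε x) =
      ∫ x : EuclideanSpace ℝ (Fin N), MvPolynomial.eval (fun i => x i) (divDiff η p) *
        (⟪η, x⟫_ℝ ^ 2 / (⟪η, x⟫_ℝ ^ 2 + ε)) * (Real.exp (-‖x‖ ^ 2) * S.regWeight ε x) := by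
  have h1 := (rootReflection η).measurePreserving.integral_comp
    (rootReflection η).toHomeomorph.measurableEmbedding
    (fun x : EuclideanSpace ℝ (Fin N) => MvPolynomial.eval (fun i => x i) p *
      (⟪η, x⟫_ℝ / (⟪η, x⟫_ℝ ^ 2 + ε)) * (Real.exp (-‖x‖ ^ 2) * S.regWeight ε x))
  have h2 : ∀ x : EuclideanSpace ℝ (Fin N),
      MvPolynomial.eval (fun i => rootReflection η x i) p *
        (⟪η, rootReflection η x⟫_ℝ / (⟪η, rootReflection η x⟫_ℝ ^ 2 + ε)) *
        (Real.exp (-‖rootReflection η x‖ ^ 2) * S.regWeight ε (rootReflection η x)) =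
      -(MvPolynomial.eval (fun i => x i) (reflPoly η p) * (⟪η, x⟫_ℝ / (⟪η, x⟫_ℝ ^ 2 + ε)) *
          (Real.exp (-‖x‖ ^ 2) * S.regWeight ε x)) := by
    intro x
    rw [eval_reflPoly, S.regWeight_rootReflection hη, LinearIsometryEquiv.norm_map,
      ← inner_rootReflection_left, rootReflection_self, inner_neg_left, neg_sq, neg_div]
    ring
  simp only [h2] at h1
  rw [integral_neg] at h1
  rw [two_mul]
  nth_rw 1 [← h1]
  rw [neg_add_eq_sub, ← integral_sub (S.integrable_eval_mul_div p η hε hε1)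
    (S.integrable_eval_mul_div _ η hε hε1)]
  refine integral_congr_ae (Eventually.of_forall fun x => ?_)
  have h3 := congrArg (MvPolynomial.eval fun i => x i) (linForm_mul_divDiff η p)
  rw [map_mul, map_sub, eval_linForm] at h3
  simp only
  rw [← sub_mul, ← sub_mul, ← h3]
  ring

/-- The integral of a polynomial against the Gaussian `e^{-|x|²}` and the weight. -/
noncomputable def gaussInt (p : MvPolynomial (Fin N) ℝ) : ℝ :=
  ∫ x : EuclideanSpace ℝ (Fin N), MvPolynomial.eval (fun i => x i) p *
    (Real.exp (-‖x‖ ^ 2) * S.weight x)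

theorem integrable_eval_mul_weight (p : MvPolynomial (Fin N) ℝ) :
    Integrable fun x : EuclideanSpace ℝ (Fin N) => MvPolynomial.eval (fun i => x i) p *
      (Real.exp (-‖x‖ ^ 2) * S.weight x) := by
  simpa only [regWeight_zero] using
    S.integrable_reg (expBounded_eval p) (continuous_eval_ofLp p) le_rfl zero_le_one

theorem gaussInt_add (p q : MvPolynomial (Fin N) ℝ) :
    S.gaussInt (p + q) = S.gaussInt p + S.gaussInt q := by
  rw [gaussInt, gaussInt, gaussInt, ← integral_add (S.integrable_eval_mul_weight p)
    (S.integrable_eval_mul_weight q)]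
  simp only [map_add, add_mul]

theorem gaussInt_smul (c : ℝ) (p : MvPolynomial (Fin N) ℝ) :
    S.gaussInt (c • p) = c * S.gaussInt p := by
  rw [gaussInt, gaussInt, ← integral_const_mul]
  simp only [MvPolynomial.smul_eval, mul_assoc]

/-- The Gaussian integral `gaussInt` as a linear form on polynomials. -/
noncomputable def gaussIntₗ : MvPolynomial (Fin N) ℝ →ₗ[ℝ] ℝ where
  toFun := S.gaussInt
  map_add' := S.gaussInt_add
  map_smul' := S.gaussInt_smul

theorem gaussInt_reflPoly {η : EuclideanSpace ℝ (Fin N)} (hη : η ∈ S.R)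
    (p : MvPolynomial (Fin N) ℝ) : S.gaussInt (reflPoly η p) = S.gaussInt p := by
  have h1 := (rootReflection η).measurePreserving.integral_comp
    (rootReflection η).toHomeomorph.measurableEmbedding
    (fun x : EuclideanSpace ℝ (Fin N) => MvPolynomial.eval (fun i => x i) p *
      (Real.exp (-‖x‖ ^ 2) * S.weight x))
  rw [gaussInt, gaussInt, ← h1]
  refine integral_congr_ae (Eventually.of_forall fun x => ?_)
  simp only
  rw [eval_reflPoly, S.weight_rootReflection hη, LinearIsometryEquiv.norm_map]

/-- Passage to the limit `ε = 1 / (n + 1) → 0` in the integrals against the regularized weight, with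
a bounded factor `g n` that may correct the weight. -/
theorem tendsto_integral_reg (p : MvPolynomial (Fin N) ℝ) {b : ℝ}
    {g : ℕ → EuclideanSpace ℝ (Fin N) → ℝ} (hg : ∀ n, Continuous (g n))
    (hgb : ∀ n x, |g n x| ≤ b)
    (hlim : ∀ x, Tendsto (fun n : ℕ => g n x * S.regWeight (1 / ((n : ℝ) + 1)) x) atTop
      (𝓝 (b * S.weight x))) :
    Tendsto (fun n : ℕ => ∫ x : EuclideanSpace ℝ (Fin N), MvPolynomial.eval (fun i => x i) p *
      g n x * (Real.exp (-‖x‖ ^ 2) * S.regWeight (1 / ((n : ℝ) + 1)) x)) atTop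
      (𝓝 (b * S.gaussInt p)) := by
  rw [gaussInt, ← integral_const_mul]
  have hε : ∀ n : ℕ, 0 < 1 / ((n : ℝ) + 1) := fun n => by positivity
  have hε1 : ∀ n : ℕ, 1 / ((n : ℝ) + 1) ≤ 1 := fun n => by
    rw [div_le_one (by positivity)]
    linarith [(Nat.cast_nonneg n : (0 : ℝ) ≤ n)]
  have hint : Integrable fun x : EuclideanSpace ℝ (Fin N) =>
      b * |MvPolynomial.eval (fun i => x i) p * (Real.exp (-‖x‖ ^ 2) * S.regWeight 1 x)| :=
    (S.integrable_reg (expBounded_eval p) (continuous_eval_ofLp p) zero_le_one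
      le_rfl).abs.const_mul b
  refine tendsto_integral_of_dominated_convergence
    (fun x => b * |MvPolynomial.eval (fun i => x i) p *
      (Real.exp (-‖x‖ ^ 2) * S.regWeight 1 x)|) (fun n => ?_) hint
    (fun n => Eventually.of_forall fun x => ?_) (Eventually.of_forall fun x => ?_)
  · have hw := S.continuous_regWeight_right (1 / ((n : ℝ) + 1))
    have hp := continuous_eval_ofLp p
    have hgn := hg n
    exact Continuous.aestronglyMeasurable (by fun_prop)
  · have hb : 0 ≤ b := (abs_nonneg _).trans (hgb n x)
    rw [Real.norm_eq_abs, abs_mul, abs_mul, abs_mul, abs_mul, abs_mul,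
      abs_of_pos (S.regWeight_pos (hε n) x), abs_of_pos (S.regWeight_pos one_pos x)]
    have h1 := S.regWeight_mono (hε n).le (hε1 n) x
    have h2 := S.regWeight_pos (hε n) x
    calc _ = |g n x| * (|MvPolynomial.eval (fun i => x i) p| *
          (|Real.exp (-‖x‖ ^ 2)| * S.regWeight (1 / ((n : ℝ) + 1)) x)) := by ring
      _ ≤ _ := by
        gcongr
        exact hgb n x
  · have h := (hlim x).const_mul (MvPolynomial.eval (fun i => x i) p * Real.exp (-‖x‖ ^ 2))
    convert h using 1
    · ext n
      ring
    · congr 1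
      ring

/-- The Gaussian functional satisfies `∫ T_ξ p e^{-|x|²} ω_k = 2 ∫ ⟨ξ, x⟩ p e^{-|x|²} ω_k`. The
weight is in general not differentiable on the reflecting hyperplanes; the identity is the limit
`ε → 0` of its analogue for the regularized weight. -/
theorem gaussInt_dunklOp (ξ : EuclideanSpace ℝ (Fin N)) (p : MvPolynomial (Fin N) ℝ) :
    S.gaussInt (S.dunklOp ξ p) = 2 * S.gaussInt (linForm ξ * p) := by
  have hε : ∀ n : ℕ, 0 < 1 / ((n : ℝ) + 1) := fun n => by positivity
  have hε1 : ∀ n : ℕ, 1 / ((n : ℝ) + 1) ≤ 1 := fun n => by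
    rw [div_le_one (by positivity)]
    linarith [(Nat.cast_nonneg n : (0 : ℝ) ≤ n)]
  have ht0 : Tendsto (fun n : ℕ => 1 / ((n : ℝ) + 1)) atTop (𝓝 0) :=
    tendsto_one_div_add_atTop_nhds_zero_nat
  have hw : ∀ x, Tendsto (fun n : ℕ => S.regWeight (1 / ((n : ℝ) + 1)) x) atTop
      (𝓝 (S.weight x)) := fun x => by
    rw [← S.regWeight_zero]
    exact ((S.continuous_regWeight.comp (Continuous.prodMk_left x)).tendsto 0).comp ht0
  -- the limits of both sides of the regularized identity
  have hL := S.tendsto_integral_reg (dirDeriv ξ p - 2 • (linForm ξ * p)) (b := 1)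
    (g := fun _ _ => 1) (fun _ => continuous_const) (fun _ _ => by simp)
    (fun x => by simpa only [one_mul] using hw x)
  have hR : ∀ η ∈ S.posRoots, Tendsto (fun n : ℕ => ∫ x : EuclideanSpace ℝ (Fin N),
      MvPolynomial.eval (fun i => x i) (divDiff η p) *
        (S.k η * (⟪η, x⟫_ℝ ^ 2 / (⟪η, x⟫_ℝ ^ 2 + 1 / ((n : ℝ) + 1)))) *
        (Real.exp (-‖x‖ ^ 2) * S.regWeight (1 / ((n : ℝ) + 1)) x)) atTop
      (𝓝 (S.k η * S.gaussInt (divDiff η p))) := by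
    intro η hη
    have hk := S.k_nonneg_of_mem_posRoots hη
    have hb : ∀ (n : ℕ) x, |⟪η, x⟫_ℝ ^ 2 / (⟪η, x⟫_ℝ ^ 2 + 1 / ((n : ℝ) + 1))| ≤ 1 := by
      intro n x
      have := hε n
      rw [abs_of_nonneg (by positivity), div_le_one (by positivity)]
      linarith
    refine S.tendsto_integral_reg _ (fun n => ?_) (fun n x => ?_) fun x => ?_
    · refine continuous_const.mul (Continuous.div (by fun_prop) (by fun_prop) fun x => ?_)
      have := hε n
      positivity
    · rw [abs_mul, abs_of_nonneg hk]
      exact mul_le_of_le_one_right hk (hb n x)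
    · simp only [mul_assoc]
      rcases hk.eq_or_lt with hk0 | hk0
      · simp [← hk0]
      refine Tendsto.const_mul _ ?_
      by_cases hx : ⟪η, x⟫_ℝ = 0
      · -- on the hyperplane the weight vanishes, since `k η > 0`
        have h0 : S.weight x = 0 := Finset.prod_eq_zero hη (by
          rw [hx, abs_zero, Real.zero_rpow (by positivity)])
        simp [hx, h0]
      · have h1 : Tendsto (fun n : ℕ => ⟪η, x⟫_ℝ ^ 2 / (⟪η, x⟫_ℝ ^ 2 + 1 / ((n : ℝ) + 1))) atTop
            (𝓝 (⟪η, x⟫_ℝ ^ 2 / (⟪η, x⟫_ℝ ^ 2 + 0))) :=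
          tendsto_const_nhds.div (ht0.const_add _) (by positivity)
        rw [add_zero, div_self (by positivity)] at h1
        simpa using h1.mul (hw x)
  have hR' := (tendsto_finsetSum S.posRoots fun η hη => (hR η hη).const_mul ⟪η, ξ⟫_ℝ).neg
  have heq := tendsto_nhds_unique hL (hR'.congr fun n => ?_)
  · change S.gaussIntₗ (S.dunklOp ξ p) = 2 * S.gaussIntₗ (linForm ξ * p)
    change 1 * S.gaussIntₗ (dirDeriv ξ p - 2 • (linForm ξ * p)) =
      -∑ η ∈ S.posRoots, ⟪η, ξ⟫_ℝ * (S.k η * S.gaussIntₗ (divDiff η p)) at heq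
    rw [map_sub, map_nsmul, one_mul, nsmul_eq_mul] at heq
    rw [dunklOp_apply, map_add, map_sum]
    simp only [map_smul, smul_eq_mul]
    have : ∑ η ∈ S.posRoots, S.k η * ⟪η, ξ⟫_ℝ * S.gaussIntₗ (divDiff η p) =
        ∑ η ∈ S.posRoots, ⟪η, ξ⟫_ℝ * (S.k η * S.gaussIntₗ (divDiff η p)) :=
      Finset.sum_congr rfl fun η _ => by ring
    push_cast at heq
    linarith
  · simp only [mul_one]
    rw [S.integral_dirDeriv_reg p ξ (hε n) (hε1 n)]
    congr 1
    refine Finset.sum_congr rfl fun η hη => ?_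
    rw [S.integral_symm_reg p (S.mem_posRoots.1 hη).1 (hε n) (hε1 n), mul_right_comm, mul_comm,
      ← integral_const_mul]
    congr 1
    refine integral_congr_ae (Eventually.of_forall fun x => ?_)
    simp only
    ring

/-- The correction to the Leibniz rule for divided differences, `⟨η, ·⟩ D_η p · D_η q`, is odd
under `σ_η`. -/
theorem gaussInt_divDiff_mul {η : EuclideanSpace ℝ (Fin N)} (hη : η ∈ S.R)
    (p q : MvPolynomial (Fin N) ℝ) :
    S.gaussInt (divDiff η p * q + p * divDiff η q - divDiff η (p * q)) = 0 := by
  have hη0 := S.root_ne_zero η hη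
  have h1 : divDiff η p * q + p * divDiff η q - divDiff η (p * q) =
      linForm η * (divDiff η p * divDiff η q) := by
    have hp := linForm_mul_divDiff η p
    have hq := linForm_mul_divDiff η q
    have hpq := linForm_mul_divDiff η (p * q)
    rw [map_mul (reflPoly η)] at hpq
    refine mul_left_cancel₀ (linForm_ne_zero hη0) ?_
    linear_combination q * hp + p * hq - hpq - (linForm η * divDiff η q) * hp -
      (p - reflPoly η p) * hq
  have h2 : ∀ r, reflPoly η (divDiff η r) = divDiff η r := fun r => by
    rw [reflPoly_divDiff hη0, rootReflection_self, divDiff_neg hη0, neg_eq_iff_eq_neg]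
    refine divDiff_eq_of_linForm_mul hη0 ?_
    rw [mul_neg, linForm_mul_divDiff, reflPoly_reflPoly, neg_sub]
  have h3 := S.gaussInt_reflPoly hη (linForm η * (divDiff η p * divDiff η q))
  rw [map_mul, map_mul, h2, h2, reflPoly_linForm, rootReflection_self, linForm_neg, neg_mul,
    ← neg_one_smul ℝ, gaussInt_smul] at h3
  rw [h1]
  linarith

/-- With respect to the Gaussian weight, the adjoint of `T_m` is `2 x_m - T_m`. -/
theorem gaussInt_dunklOpBasis_mul (m : Fin N) (p q : MvPolynomial (Fin N) ℝ) :
    S.gaussInt (S.dunklOpBasis m p * q) =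
      S.gaussInt (p * (2 • (MvPolynomial.X m * q) - S.dunklOpBasis m q)) := by
  have hX : linForm (EuclideanSpace.single m (1 : ℝ)) = (MvPolynomial.X m : MvPolynomial _ ℝ) :=
    eq_of_eval_ofLp_eq fun x => by
      rw [eval_linForm, MvPolynomial.eval_X]
      simp [EuclideanSpace.inner_single_left]
  have h := S.gaussInt_dunklOp (EuclideanSpace.single m 1) (p * q)
  set ξ : EuclideanSpace ℝ (Fin N) := EuclideanSpace.single m 1
  have h1 : S.dunklOp ξ p * q + p * S.dunklOp ξ q = S.dunklOp ξ (p * q) +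
      ∑ η ∈ S.posRoots, (S.k η * ⟪η, ξ⟫_ℝ) •
        (divDiff η p * q + p * divDiff η q - divDiff η (p * q)) := by
    simp only [dunklOp_apply, smul_sub, smul_add, Finset.sum_add_distrib, Finset.sum_sub_distrib,
      add_mul, mul_add, Finset.sum_mul, Finset.mul_sum, smul_mul_assoc, mul_smul_comm,
      Derivation.leibniz, smul_eq_mul]
    ring
  have h2 := congrArg S.gaussIntₗ h1
  rw [map_add, map_add, map_sum, Finset.sum_eq_zero fun η hη => by
    rw [map_smul]
    change _ • S.gaussInt _ = 0
    rw [S.gaussInt_divDiff_mul (S.mem_posRoots.1 hη).1, smul_zero], add_zero] at h2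
  change S.gaussIntₗ (S.dunklOp ξ p * q) =
    S.gaussIntₗ (p * (2 • (MvPolynomial.X m * q) - S.dunklOp ξ q))
  change S.gaussIntₗ _ = 2 * S.gaussIntₗ _ at h
  rw [mul_sub, map_sub, mul_smul_comm, map_nsmul, nsmul_eq_mul, mul_left_comm, ← hX]
  push_cast
  linarith

/-! ### The Macdonald identity -/

theorem gaussInt_one_pos : 0 < S.gaussInt 1 := by
  have hc : Continuous fun x : EuclideanSpace ℝ (Fin N) =>
      MvPolynomial.eval (fun i => x i) 1 * (Real.exp (-‖x‖ ^ 2) * S.weight x) := by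
    have := S.weight_continuous
    simp only [map_one]
    fun_prop
  refine integral_pos_of_integrable_nonneg_nonzero (x := S.v) hc (S.integrable_eval_mul_weight 1)
    (fun x => ?_) ?_
  · rw [map_one, one_mul]
    exact mul_nonneg (Real.exp_nonneg _) (S.weight_nonneg x)
  · -- the weight does not vanish at the regular vector `v`
    have hv : 0 < S.weight S.v := Finset.prod_pos fun η hη => by
      have := (S.mem_posRoots.1 hη).2
      positivity
    rw [map_one, one_mul]
    positivity

theorem mehtaConst_eq : S.mehtaConst = (S.gaussInt 1)⁻¹ := by
  simp only [mehtaConst, gaussInt, map_one, one_mul]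

theorem mehtaConst_pos : 0 < S.mehtaConst := by
  rw [mehtaConst_eq]
  exact inv_pos.2 S.gaussInt_one_pos

/-- The bilinear form `c_k ∫ e^{-Δ_k/4} p · e^{-Δ_k/4} q · e^{-|x|²} ω_k`. -/
noncomputable def gaussForm (p q : MvPolynomial (Fin N) ℝ) : ℝ :=
  S.mehtaConst * S.gaussInt (S.expNegLaplacian p * S.expNegLaplacian q)

theorem gaussForm_comm (p q : MvPolynomial (Fin N) ℝ) : S.gaussForm p q = S.gaussForm q p := by
  rw [gaussForm, gaussForm, mul_comm (S.expNegLaplacian p)]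

theorem gaussForm_add_left (p p' q : MvPolynomial (Fin N) ℝ) :
    S.gaussForm (p + p') q = S.gaussForm p q + S.gaussForm p' q := by
  rw [gaussForm, expNegLaplacian_add, add_mul, gaussInt_add, mul_add, gaussForm, gaussForm]

theorem gaussForm_smul_left (a : ℝ) (p q : MvPolynomial (Fin N) ℝ) :
    S.gaussForm (a • p) q = a * S.gaussForm p q := by
  rw [gaussForm, expNegLaplacian_smul, smul_mul_assoc, gaussInt_smul, mul_left_comm, gaussForm]

/-- In the Gaussian form, the adjoint of the multiplication by `x_m` is `T_m / 2`. -/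
theorem gaussForm_X_mul (m : Fin N) (p q : MvPolynomial (Fin N) ℝ) :
    S.gaussForm (MvPolynomial.X m * p) q = 1 / 2 * S.gaussForm p (S.dunklOpBasis m q) := by
  have h := S.gaussInt_dunklOpBasis_mul m (S.expNegLaplacian q) (S.expNegLaplacian p)
  have e : S.expNegLaplacian (MvPolynomial.X m * p) * S.expNegLaplacian q =
      (1 / 2 : ℝ) • (S.expNegLaplacian q * (2 • (MvPolynomial.X m * S.expNegLaplacian p) -
        S.dunklOpBasis m (S.expNegLaplacian p))) := by
    rw [expNegLaplacian_X_mul, mul_comm, ← mul_smul_comm]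
    congr 1
    module
  rw [gaussForm, e, gaussInt_smul, ← h, gaussForm, expNegLaplacian_dunklOpBasis,
    mul_comm (S.expNegLaplacian p)]
  ring

theorem gaussForm_X_pow_mul (m : Fin N) (n : ℕ) (p q : MvPolynomial (Fin N) ℝ) :
    S.gaussForm (MvPolynomial.X m ^ n * p) q =
      (1 / 2) ^ n * S.gaussForm p ((S.dunklOpBasis m ^ n) q) := by
  induction n generalizing q with
  | zero => simp
  | succ n ih =>
    rw [pow_succ', mul_assoc, gaussForm_X_mul, ih, ← Module.End.mul_apply, ← pow_succ]
    ring

theorem gaussForm_list_prod_mul (l : List (Fin N)) (ν : Fin N → ℕ)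
    (p q : MvPolynomial (Fin N) ℝ) :
    S.gaussForm ((l.map fun i => MvPolynomial.X i ^ ν i).prod * p) q =
      (1 / 2) ^ (l.map ν).sum *
        S.gaussForm p ((l.map fun i => S.dunklOpBasis i ^ ν i).prod q) := by
  induction l generalizing p with
  | nil => simp
  | cons a l ih =>
    rw [List.map_cons, List.prod_cons, mul_comm (MvPolynomial.X a ^ ν a), mul_assoc, ih,
      gaussForm_X_pow_mul, List.map_cons, List.sum_cons, List.map_cons, List.prod_cons,
      Module.End.mul_apply, pow_add]
    ring

/-- The Gaussian form and the Dunkl pairing agree on `(1, q)`: for `q = x_m q'` the form is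
`⟨q', T_m 1⟩ / 2 = 0`. -/
theorem gaussForm_one_left (q : MvPolynomial (Fin N) ℝ) :
    S.gaussForm 1 q = MvPolynomial.eval 0 q := by
  have h1 : S.expNegLaplacian 1 = 1 := by
    simpa only [map_one] using S.expNegLaplacian_C 1
  induction q using MvPolynomial.induction_on with
  | C a =>
    have e : (MvPolynomial.C a : MvPolynomial (Fin N) ℝ) = a • 1 := by
      rw [MvPolynomial.smul_eq_C_mul, mul_one]
    rw [e, gaussForm_comm, gaussForm_smul_left, gaussForm, h1, mul_one, mehtaConst_eq,
      inv_mul_cancel₀ S.gaussInt_one_pos.ne']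
    simp
  | add p q hp hq => rw [gaussForm_comm, gaussForm_add_left, gaussForm_comm, hp, gaussForm_comm,
      hq, map_add]
  | mul_X p m hp =>
    have hT : S.dunklOpBasis m 1 = 0 := by
      rw [dunklOpBasis, ← map_one MvPolynomial.C, dunklOp_C]
    rw [mul_comm, gaussForm_comm, gaussForm_X_mul, hT, gaussForm_comm,
      ← zero_smul ℝ (1 : MvPolynomial (Fin N) ℝ), gaussForm_smul_left]
    simp

/-- The Macdonald identity: on homogeneous polynomials the Gaussian form is a multiple of the Dunkl
pairing. -/
theorem pairing_eq_gaussForm {n : ℕ} {p : MvPolynomial (Fin N) ℝ} (hp : p.IsHomogeneous n)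
    (q : MvPolynomial (Fin N) ℝ) : S.pairing p q = 2 ^ n * S.gaussForm p q := by
  have hmon : ∀ ν ∈ p.support, S.gaussForm (MvPolynomial.monomial ν 1) q =
      (1 / 2) ^ n *
        MvPolynomial.eval 0 ((List.ofFn fun i => S.dunklOpBasis i ^ ν i).prod q) := by
    intro ν hν
    have hdeg : ((List.finRange N).map ν).sum = n := by
      rw [← List.ofFn_eq_map, List.sum_ofFn]
      have := hp (MvPolynomial.mem_support_iff.1 hν)
      rw [← this, Finsupp.weight_apply, Finsupp.sum_fintype]
      · simp
      · simp
    have e : (MvPolynomial.monomial ν 1 : MvPolynomial (Fin N) ℝ) =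
        ((List.finRange N).map fun i => MvPolynomial.X i ^ ν i).prod * 1 := by
      rw [← List.ofFn_eq_map, List.prod_ofFn, mul_one, MvPolynomial.monomial_eq, map_one, one_mul,
        Finsupp.prod_fintype]
      simp
    rw [e, gaussForm_list_prod_mul, hdeg, gaussForm_one_left, List.ofFn_eq_map]
  let B : MvPolynomial (Fin N) ℝ →ₗ[ℝ] ℝ :=
    { toFun := fun r => S.gaussForm r q
      map_add' := fun r r' => S.gaussForm_add_left r r' q
      map_smul' := fun a r => S.gaussForm_smul_left a r q }
  have hB : S.gaussForm p q = ∑ ν ∈ p.support,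
      p.coeff ν * S.gaussForm (MvPolynomial.monomial ν 1) q := by
    change B p = ∑ ν ∈ p.support, p.coeff ν * B (MvPolynomial.monomial ν 1)
    conv_lhs => rw [p.as_sum, map_sum]
    refine Finset.sum_congr rfl fun ν _ => ?_
    rw [← smul_eq_mul, ← map_smul, MvPolynomial.smul_monomial, smul_eq_mul, mul_one]
  rw [hB, pairing, polyDunkl, LinearMap.sum_apply, map_sum, Finset.mul_sum]
  refine Finset.sum_congr rfl fun ν hν => ?_
  rw [hmon ν hν, LinearMap.smul_apply, MvPolynomial.smul_eval, mul_left_comm, ← mul_assoc (2 ^ n),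
    ← mul_pow]
  norm_num

/-! ### Orthonormality of the generalized Hermite functions -/

variable {φ : (Fin N → ℕ) → MvPolynomial (Fin N) ℝ}

theorem integral_measure (f : EuclideanSpace ℝ (Fin N) → ℂ) :
    ∫ x, f x ∂S.measure = ∫ x, (S.weight x : ℂ) * f x := by
  rw [measure, integral_withDensity_eq_integral_toReal_smul
    S.weight_continuous.measurable.ennreal_ofReal
    (Eventually.of_forall fun _ => ENNReal.ofReal_lt_top)]
  refine integral_congr_ae (Eventually.of_forall fun x => ?_)
  simp only
  rw [ENNReal.toReal_ofReal (S.weight_nonneg x), Complex.real_smul]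

/-- By the Macdonald identity the inner product is `2^{(|μ| - |ν|)/2} [φ_ν, φ_μ]_k`. -/
theorem inner_hermite (hφ : S.IsHomogeneousOrthonormalBasis φ) (ν μ : Fin N → ℕ) :
    inner ℂ (S.hermite φ ν) (S.hermite φ μ) = if ν = μ then 1 else 0 := by
  set a : ℝ := 2 ^ (((∑ i, ν i : ℕ) : ℝ) / 2) with ha
  set b : ℝ := 2 ^ (((∑ i, μ i : ℕ) : ℝ) / 2) with hb
  have ha0 : 0 < a := by positivity
  have hb0 : 0 < b := by positivity
  have ha2 : (2 : ℝ) ^ (∑ i, ν i) = a ^ 2 := by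
    rw [ha, ← Real.rpow_natCast, ← Real.rpow_natCast, ← Real.rpow_mul zero_le_two]
    norm_num
  have hb2 : (2 : ℝ) ^ (∑ i, μ i) = b ^ 2 := by
    rw [hb, ← Real.rpow_natCast, ← Real.rpow_natCast, ← Real.rpow_mul zero_le_two]
    norm_num
  have h1 : inner ℂ (S.hermite φ ν) (S.hermite φ μ) =
      ((a * b * S.gaussForm (φ ν) (φ μ) : ℝ) : ℂ) := by
    rw [L2.inner_def]
    have e : ∫ x, inner ℂ (S.hermite φ ν x) (S.hermite φ μ x) ∂S.measure =
        ∫ x, inner ℂ (S.hermiteFun φ ν x) (S.hermiteFun φ μ x) ∂S.measure := by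
      refine integral_congr_ae ?_
      filter_upwards [(S.hermiteFun_memLp φ ν).coeFn_toLp, (S.hermiteFun_memLp φ μ).coeFn_toLp]
        with x hx hx'
      rw [hermite, hermite, hx, hx']
    rw [e, S.integral_measure, gaussForm, gaussInt, ← integral_const_mul, ← integral_const_mul,
      ← integral_complex_ofReal]
    refine integral_congr_ae (Eventually.of_forall fun x => ?_)
    simp only [hermiteFun, hermitePoly, RCLike.inner_apply, Complex.conj_ofReal,
      MvPolynomial.smul_eval, ← Complex.ofReal_mul, map_mul]
    congr 1
    rw [← ha, ← hb, ha2, hb2]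
    have hs := Real.mul_self_sqrt S.mehtaConst_pos.le
    have hexp : Real.exp (-‖x‖ ^ 2 / 2) * Real.exp (-‖x‖ ^ 2 / 2) = Real.exp (-‖x‖ ^ 2) := by
      rw [← Real.exp_add]
      ring_nf
    rw [← hexp]
    nth_rw 3 [← hs]
    field_simp
  rw [h1]
  have h2 := S.pairing_eq_gaussForm (hφ.homogeneous ν) (φ μ)
  rw [hφ.orthonormal, ha2] at h2
  split_ifs at h2 ⊢ with h
  · have hab : a = b := by rw [ha, hb, h]
    rw [← hab, ← pow_two, ← h2, Complex.ofReal_one]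
  · have : S.gaussForm (φ ν) (φ μ) = 0 := by
      rcases mul_eq_zero.1 h2.symm with h | h
      · exact absurd h (by positivity)
      · exact h
    rw [this, mul_zero, Complex.ofReal_zero]

theorem orthonormal_hermite (hφ : S.IsHomogeneousOrthonormalBasis φ) :
    Orthonormal ℂ (S.hermite φ) := by
  classical
  exact orthonormal_iff_ite.2 fun ν μ => S.inner_hermite hφ ν μ

end Datum

/-! ### Injectivity of the Fourier transform on integrable functions -/

open scoped FourierTransform ContDiff SchwartzMap in
/-- By duality with Schwartz functions, on which the Fourier transform is bijective. -/
theorem ae_eq_zero_of_fourier_eq_zero {V : Type*} [NormedAddCommGroup V] [InnerProductSpace ℝ V]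
    [MeasurableSpace V] [BorelSpace V] [FiniteDimensional ℝ V] {G : V → ℂ} (hG : Integrable G)
    (h : 𝓕 G = 0) : G =ᵐ[volume] 0 := by
  refine ae_eq_zero_of_integral_contDiff_smul_eq_zero hG.locallyIntegrable fun g hg hgc => ?_
  have hg₁ : HasCompactSupport (Complex.ofRealCLM ∘ g) := hgc.comp_left rfl
  have hg₂ : ContDiff ℝ ∞ (Complex.ofRealCLM ∘ g) := by fun_prop
  -- the test function is the Fourier transform of a Schwartz function `ψ`
  set u : 𝓢(V, ℂ) := hg₁.toSchwartzMap hg₂ with hu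
  set ψ : 𝓢(V, ℂ) := 𝓕⁻ u with hψ
  have hψu : 𝓕 (ψ : V → ℂ) = u := by
    rw [← SchwartzMap.fourier_coe, hψ, FourierTransform.fourier_fourierInv_eq]
  have key := VectorFourier.integral_fourierIntegral_smul_eq_flip (L := innerₗ V)
    (μ := volume) (ν := volume) Real.continuous_fourierChar continuous_inner ψ.integrable hG
  have h1 : ∀ x, VectorFourier.fourierIntegral Real.fourierChar volume (innerₗ V) (ψ : V → ℂ) x =
      (g x : ℂ) := fun x => congrFun hψu x
  have h2 : ∀ x, VectorFourier.fourierIntegral Real.fourierChar volume (innerₗ V).flip G x = 0 := by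
    intro x
    rw [flip_innerₗ]
    exact congrFun h x
  simpa only [h1, h2, smul_zero, integral_zero, Complex.coe_smul] using key

namespace Datum

variable (S : Datum N)

/-! ### Completeness of the generalized Hermite functions -/

theorem expBounded_weight : ExpBounded S.weight := by
  obtain ⟨c, hc, h⟩ := S.weight_growth
  exact ⟨1, c, zero_le_one, hc, fun x => by
    rw [abs_of_nonneg (S.weight_nonneg x), one_mul]
    exact h x⟩

/-- A continuous function of exponential growth times the Gaussian `e^{-|x|²/2}` belongs to
`L²(ω_k dx)`. -/
theorem memLp_expBounded {f : EuclideanSpace ℝ (Fin N) → ℝ} (hf : ExpBounded f)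
    (hc : Continuous f) :
    MemLp (fun x => ((f x * Real.exp (-‖x‖ ^ 2 / 2) : ℝ) : ℂ)) 2 S.measure := by
  have hw := S.weight_continuous
  have hcont : Continuous fun x : EuclideanSpace ℝ (Fin N) =>
      ((f x * Real.exp (-‖x‖ ^ 2 / 2) : ℝ) : ℂ) := by fun_prop
  rw [memLp_two_iff_integrable_sq_norm hcont.aestronglyMeasurable, measure,
    integrable_withDensity_iff_integrable_smul₀'
      (S.weight_continuous.measurable.ennreal_ofReal.aemeasurable)
      (Eventually.of_forall fun _ => ENNReal.ofReal_lt_top)]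
  have hm : Continuous fun x => S.weight x * (f x * f x) := by fun_prop
  refine ((S.expBounded_weight.mul (hf.mul hf)).integrable_mul_exp hm.aestronglyMeasurable).congr
    (Eventually.of_forall fun x => ?_)
  have hexp : Real.exp (-‖x‖ ^ 2 / 2) * Real.exp (-‖x‖ ^ 2 / 2) = Real.exp (-‖x‖ ^ 2) := by
    rw [← Real.exp_add]
    ring_nf
  simp only
  rw [ENNReal.toReal_ofReal (S.weight_nonneg x), Complex.norm_real, Real.norm_eq_abs, sq_abs,
    ← hexp, smul_eq_mul]
  ring

theorem integrable_expBounded_mul {f : EuclideanSpace ℝ (Fin N) → ℝ} (hf : ExpBounded f)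
    (hc : Continuous f) (g : S.L2) :
    Integrable (fun x => ((f x * Real.exp (-‖x‖ ^ 2 / 2) : ℝ) : ℂ) * g x) S.measure :=
  (S.memLp_expBounded hf hc).integrable_mul (Lp.memLp g)

theorem integrable_weight_mul {f : EuclideanSpace ℝ (Fin N) → ℂ} (hf : Integrable f S.measure) :
    Integrable fun x => (S.weight x : ℂ) * f x := by
  rw [measure, integrable_withDensity_iff_integrable_smul₀'
    (S.weight_continuous.measurable.ennreal_ofReal.aemeasurable)
    (Eventually.of_forall fun _ => ENNReal.ofReal_lt_top)] at hf
  refine hf.congr (Eventually.of_forall fun x => ?_)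
  simp only
  rw [ENNReal.toReal_ofReal (S.weight_nonneg x), Complex.real_smul]

theorem ae_measure_iff {P : EuclideanSpace ℝ (Fin N) → Prop} :
    (∀ᵐ x ∂S.measure, P x) ↔ ∀ᵐ x, S.weight x ≠ 0 → P x := by
  rw [measure, ae_withDensity_iff S.weight_continuous.measurable.ennreal_ofReal]
  refine eventually_congr (Eventually.of_forall fun x => ?_)
  rw [Ne, ENNReal.ofReal_eq_zero, (S.weight_nonneg x).ge_iff_eq']

/-- The functional `p ↦ ∫ p(x) e^{-|x|²/2} g(x) ω_k(x) dx` on polynomials. -/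
noncomputable def moment (g : S.L2) : MvPolynomial (Fin N) ℝ →ₗ[ℝ] ℂ where
  toFun p := ∫ x, ((MvPolynomial.eval (fun i => x i) p * Real.exp (-‖x‖ ^ 2 / 2) : ℝ) : ℂ) *
    g x ∂S.measure
  map_add' p q := by
    rw [← integral_add
      (S.integrable_expBounded_mul (expBounded_eval p) (continuous_eval_ofLp p) g)
      (S.integrable_expBounded_mul (expBounded_eval q) (continuous_eval_ofLp q) g)]
    refine integral_congr_ae (Eventually.of_forall fun x => ?_)
    simp only [map_add]
    push_cast
    ring
  map_smul' a p := by
    rw [RingHom.id_apply, Complex.real_smul, ← integral_const_mul]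
    refine integral_congr_ae (Eventually.of_forall fun x => ?_)
    simp only [MvPolynomial.smul_eval]
    push_cast
    ring

theorem moment_apply (g : S.L2) (p : MvPolynomial (Fin N) ℝ) :
    S.moment g p = ∫ x, ((MvPolynomial.eval (fun i => x i) p * Real.exp (-‖x‖ ^ 2 / 2) : ℝ) : ℂ) *
      g x ∂S.measure := rfl

variable {φ : (Fin N → ℕ) → MvPolynomial (Fin N) ℝ}

theorem inner_hermite_eq_moment (ν : Fin N → ℕ) (g : S.L2) :
    inner ℂ (S.hermite φ ν) g =
      ((√S.mehtaConst / (2 : ℝ) ^ (((∑ i, ν i : ℕ) : ℝ) / 2) : ℝ) : ℂ) *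
        S.moment g (S.hermitePoly φ ν) := by
  rw [L2.inner_def, moment_apply, ← integral_const_mul]
  refine integral_congr_ae ?_
  filter_upwards [(S.hermiteFun_memLp φ ν).coeFn_toLp] with x hx
  rw [hermite, hx, hermiteFun, RCLike.inner_apply, Complex.conj_ofReal]
  push_cast
  ring

/-- A function orthogonal to all generalized Hermite functions is orthogonal to all products of a
polynomial with the Gaussian, because `e^{-Δ_k/4}` is surjective. -/
theorem moment_eq_zero (hφ : S.IsHomogeneousOrthonormalBasis φ) {g : S.L2}
    (hg : ∀ ν, inner ℂ (S.hermite φ ν) g = 0) (p : MvPolynomial (Fin N) ℝ) :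
    S.moment g p = 0 := by
  have h1 : ∀ ν, S.moment g (S.expNegLaplacian (φ ν)) = 0 := by
    intro ν
    have h := hg ν
    have hc := S.mehtaConst_pos
    have h0 : ((√S.mehtaConst / (2 : ℝ) ^ (((∑ i, ν i : ℕ) : ℝ) / 2) : ℝ) : ℂ) ≠ 0 := by
      rw [Complex.ofReal_ne_zero]
      positivity
    rw [inner_hermite_eq_moment, hermitePoly, map_smul] at h
    rcases smul_eq_zero.1 ((mul_eq_zero.1 h).resolve_left h0) with h2 | h2
    · exact absurd h2 (by positivity)
    · exact h2
  have h2 : (S.moment g).comp S.expNegLaplacianₗ = 0 :=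
    LinearMap.ext_on_range hφ.span_eq_top h1
  obtain ⟨q, rfl⟩ := S.expNegLaplacian_surjective p
  exact LinearMap.congr_fun h2 q

/-- Expanding the exponential series: if all moments of `g` vanish, then so does the Fourier
transform of `e^{-|x|²/2} g ω_k`. -/
theorem integral_cexp_mul_eq_zero {g : S.L2} (hg : ∀ p, S.moment g p = 0)
    (ξ : EuclideanSpace ℝ (Fin N)) :
    ∫ x, Complex.exp (⟪ξ, x⟫_ℝ * Complex.I) *
      (((Real.exp (-‖x‖ ^ 2 / 2) : ℝ) : ℂ) * g x) ∂S.measure = 0 := by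
  have hgm : AEStronglyMeasurable g S.measure := Lp.aestronglyMeasurable g
  have hsum : ∀ x, HasSum (fun n : ℕ => (‖ξ‖ * ‖x‖) ^ n / n.factorial *
      ‖((Real.exp (-‖x‖ ^ 2 / 2) : ℝ) : ℂ) * g x‖) (Real.exp (‖ξ‖ * ‖x‖) *
      ‖((Real.exp (-‖x‖ ^ 2 / 2) : ℝ) : ℂ) * g x‖) := fun x => by
    have h := NormedSpace.expSeries_div_hasSum_exp (‖ξ‖ * ‖x‖)
    rw [← Real.exp_eq_exp_ℝ] at h
    exact h.mul_right _
  have h := hasSum_integral_of_dominated_convergence (μ := S.measure)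
    (F := fun (n : ℕ) x => (⟪ξ, x⟫_ℝ * Complex.I) ^ n / n.factorial *
      (((Real.exp (-‖x‖ ^ 2 / 2) : ℝ) : ℂ) * g x))
    (f := fun x => Complex.exp (⟪ξ, x⟫_ℝ * Complex.I) *
      (((Real.exp (-‖x‖ ^ 2 / 2) : ℝ) : ℂ) * g x))
    (fun (n : ℕ) x => (‖ξ‖ * ‖x‖) ^ n / n.factorial *
      ‖((Real.exp (-‖x‖ ^ 2 / 2) : ℝ) : ℂ) * g x‖)
    (fun n => ?_) (fun n => Eventually.of_forall fun x => ?_)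
    (Eventually.of_forall fun x => (hsum x).summable) ?_ (Eventually.of_forall fun x => ?_)
  · have hterm : ∀ n : ℕ, ∫ x, (⟪ξ, x⟫_ℝ * Complex.I) ^ n / n.factorial *
        (((Real.exp (-‖x‖ ^ 2 / 2) : ℝ) : ℂ) * g x) ∂S.measure = 0 := by
      intro n
      have e : ∀ x : EuclideanSpace ℝ (Fin N), (⟪ξ, x⟫_ℝ * Complex.I) ^ n / n.factorial *
          (((Real.exp (-‖x‖ ^ 2 / 2) : ℝ) : ℂ) * g x) = Complex.I ^ n / n.factorial *
          (((MvPolynomial.eval (fun i => x i) (linForm ξ ^ n) * Real.exp (-‖x‖ ^ 2 / 2) : ℝ) : ℂ) *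
            g x) := fun x => by
        rw [map_pow, eval_linForm]
        push_cast
        ring
      simp only [e]
      rw [integral_const_mul, ← moment_apply, hg, mul_zero]
    simp only [hterm] at h
    exact h.unique hasSum_zero
  · refine (Continuous.aestronglyMeasurable ?_).mul ((Continuous.aestronglyMeasurable ?_).mul hgm)
    · fun_prop
    · fun_prop
  · rw [norm_mul, norm_div, norm_pow, norm_mul, Complex.norm_I, mul_one, Complex.norm_real,
      Complex.norm_natCast, Real.norm_eq_abs]
    gcongr
    exact abs_real_inner_le_norm ξ x
  · have hE : ExpBounded fun x : EuclideanSpace ℝ (Fin N) => Real.exp (‖ξ‖ * ‖x‖) :=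
      ⟨1, ‖ξ‖, zero_le_one, norm_nonneg _, fun x => by
        rw [abs_of_pos (Real.exp_pos _), one_mul]⟩
    refine (S.integrable_expBounded_mul hE (by fun_prop) g).norm.congr
      (Eventually.of_forall fun x => ?_)
    simp only
    rw [(hsum x).tsum_eq, Complex.ofReal_mul, mul_assoc, norm_mul, Complex.norm_real,
      Real.norm_of_nonneg (Real.exp_nonneg _)]
  · have h := NormedSpace.expSeries_div_hasSum_exp (⟪ξ, x⟫_ℝ * Complex.I)
    rw [← Complex.exp_eq_exp_ℂ] at h
    exact h.mul_right _

/-- The generalized Hermite functions are total in `L²(ω_k dx)`. -/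
theorem eq_zero_of_inner_hermite_eq_zero (hφ : S.IsHomogeneousOrthonormalBasis φ) {g : S.L2}
    (hg : ∀ ν, inner ℂ (S.hermite φ ν) g = 0) : g = 0 := by
  have h1 := fun ξ => S.integral_cexp_mul_eq_zero (S.moment_eq_zero hφ hg) ξ
  set G : EuclideanSpace ℝ (Fin N) → ℂ :=
    fun x => (S.weight x : ℂ) * (((Real.exp (-‖x‖ ^ 2 / 2) : ℝ) : ℂ) * g x) with hGdef
  have hG : Integrable G := by
    have h2 := S.integrable_expBounded_mul (expBounded_const 1) continuous_const g
    simpa only [one_mul] using S.integrable_weight_mul h2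
  have hF : FourierTransform.fourier G = 0 := by
    ext ξ
    rw [Real.fourier_eq', Pi.zero_apply, ← h1 (-(2 * Real.pi) • ξ), integral_measure]
    refine integral_congr_ae (Eventually.of_forall fun x => ?_)
    simp only [hGdef]
    rw [real_inner_smul_left, real_inner_comm, smul_eq_mul, mul_left_comm, neg_mul, neg_mul]
  have hae := ae_eq_zero_of_fourier_eq_zero hG hF
  rw [Lp.eq_zero_iff_ae_eq_zero]
  have hres : ∀ᵐ x ∂S.measure, (g : EuclideanSpace ℝ (Fin N) → ℂ) x = 0 := by
    rw [S.ae_measure_iff]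
    filter_upwards [hae] with x hx hw
    have hw' : (S.weight x : ℂ) ≠ 0 := Complex.ofReal_ne_zero.2 hw
    have hexp : ((Real.exp (-‖x‖ ^ 2 / 2) : ℝ) : ℂ) ≠ 0 :=
      Complex.ofReal_ne_zero.2 (Real.exp_ne_zero _)
    exact (mul_eq_zero.1 ((mul_eq_zero.1 hx).resolve_left hw')).resolve_left hexp
  exact hres

end Datum

/-! ### Diagonal unitary groups -/

section Diagonal

variable {ι H : Type*} [NormedAddCommGroup H] [InnerProductSpace ℂ H]

theorem orthonormal_smul_of_norm_eq_one {e : ι → H} (he : Orthonormal ℂ e) {c : ι → ℂ}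
    (hc : ∀ i, ‖c i‖ = 1) : Orthonormal ℂ fun i => c i • e i :=
  ⟨fun i => by rw [norm_smul, hc, he.1, one_mul], fun i j hij => by
    simp only [inner_smul_left, inner_smul_right, he.2 hij, mul_zero]⟩

/-- A family of linear isometries that is strongly continuous on the vectors of a Hilbert basis is
strongly continuous. -/
theorem continuous_apply_of_hilbertBasis (b : HilbertBasis ι ℂ H) {X : Type*} [TopologicalSpace X]
    (V : X → H ≃ₗᵢ[ℂ] H) (hV : ∀ i, Continuous fun a => V a (b i)) (f : H) :
    Continuous fun a => V a f := by
  let K : Submodule ℂ H :=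
    { carrier := {f | Continuous fun a => V a f}
      add_mem' := fun {f g} hf hg => by
        change Continuous fun a => V a (f + g)
        simpa only [map_add] using Continuous.fun_add hf hg
      zero_mem' := by
        change Continuous fun a => V a 0
        simpa only [map_zero] using continuous_const
      smul_mem' := fun z f hf => by
        change Continuous fun a => V a (z • f)
        simpa only [map_smul] using Continuous.fun_const_smul hf z }
  have hspan : Submodule.span ℂ (Set.range b) ≤ K :=
    Submodule.span_le.2 (Set.range_subset_iff.2 hV)
  refine continuous_of_uniform_approx_of_continuous fun u hu => ?_
  obtain ⟨ε, hε, hεu⟩ := Metric.mem_uniformity_dist.1 hu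
  have hf : f ∈ closure (Submodule.span ℂ (Set.range b) : Set H) := by
    rw [← Submodule.topologicalClosure_coe, b.dense_span]
    trivial
  obtain ⟨g, hg, hfg⟩ := Metric.mem_closure_iff.1 hf ε hε
  exact ⟨fun a => V a g, hspan hg, fun a => hεu (by rwa [(V a).dist_map])⟩

variable [CompleteSpace H]

/-- The Hilbert basis obtained from `b` by multiplying its vectors by the unit scalars `c i`. -/
noncomputable def rotateBasis (b : HilbertBasis ι ℂ H) (c : ι → ℂ) (hc : ∀ i, ‖c i‖ = 1) :
    HilbertBasis ι ℂ H :=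
  HilbertBasis.mkOfOrthogonalEqBot (orthonormal_smul_of_norm_eq_one b.orthonormal hc) (by
    rw [Submodule.eq_bot_iff]
    intro x hx
    refine b.repr.injective ?_
    ext i
    have h := (Submodule.mem_orthogonal _ x).1 hx (c i • b i) (Submodule.subset_span ⟨i, rfl⟩)
    rw [inner_smul_left, mul_eq_zero] at h
    rw [map_zero, b.repr_apply_apply, h.resolve_left fun h0 => ?_]
    · rfl
    · have h1 := hc i
      rw [← RCLike.norm_conj, h0, norm_zero] at h1
      exact zero_ne_one h1)

theorem rotateBasis_apply (b : HilbertBasis ι ℂ H) (c : ι → ℂ) (hc : ∀ i, ‖c i‖ = 1) (i : ι) :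
    rotateBasis b c hc i = c i • b i := by
  rw [rotateBasis, HilbertBasis.coe_mkOfOrthogonalEqBot]

/-- The diagonal unitary operator that multiplies the basis vector `b i` by the unit scalar
`c i`. -/
noncomputable def diagonalUnitary (b : HilbertBasis ι ℂ H) (c : ι → ℂ) (hc : ∀ i, ‖c i‖ = 1) :
    H ≃ₗᵢ[ℂ] H :=
  b.repr.trans (rotateBasis b c hc).repr.symm

theorem hasSum_diagonalUnitary (b : HilbertBasis ι ℂ H) (c : ι → ℂ) (hc : ∀ i, ‖c i‖ = 1)
    (f : H) :
    HasSum (fun i => (c i * inner ℂ (b i) f) • b i) (diagonalUnitary b c hc f) := by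
  have h := (rotateBasis b c hc).hasSum_repr_symm (b.repr f)
  change HasSum _ ((rotateBasis b c hc).repr.symm (b.repr f))
  simpa only [rotateBasis_apply, b.repr_apply_apply, smul_smul, mul_comm (inner ℂ _ _)] using h

theorem inner_diagonalUnitary (b : HilbertBasis ι ℂ H) (c : ι → ℂ) (hc : ∀ i, ‖c i‖ = 1)
    (f : H) (i : ι) :
    inner ℂ (b i) (diagonalUnitary b c hc f) = c i * inner ℂ (b i) f := by
  have h : inner ℂ (c i • b i) (diagonalUnitary b c hc f) = inner ℂ (b i) f := by
    rw [← rotateBasis_apply b c hc, ← HilbertBasis.repr_apply_apply, diagonalUnitary,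
      LinearIsometryEquiv.trans_apply, LinearIsometryEquiv.apply_symm_apply, b.repr_apply_apply]
  rw [← h, inner_smul_left, ← mul_assoc, Complex.mul_conj, Complex.normSq_eq_norm_sq, hc]
  simp

/-- A family of operators that is diagonal in a Hilbert basis, with eigenvalues `e^{i n α}` for
natural numbers `n`, is a strongly continuous unitary group. -/
theorem isUnitaryC0Group_diagonal (b : HilbertBasis ι ℂ H) (n : ι → ℕ) {U : ℝ → H → H}
    (hU : ∀ (α : ℝ) f, HasSum
      (fun i => (Complex.exp (Complex.I * (n i : ℂ) * (α : ℂ)) * inner ℂ (b i) f) • b i) (U α f)) :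
    IsUnitaryC0Group U := by
  have hc : ∀ (α : ℝ) i, ‖Complex.exp (Complex.I * (n i : ℂ) * (α : ℂ))‖ = 1 := fun α i => by
    rw [show Complex.I * (n i : ℂ) * (α : ℂ) = ((n i * α : ℝ) : ℂ) * Complex.I by push_cast; ring,
      Complex.norm_exp_ofReal_mul_I]
  let V : ℝ → H ≃ₗᵢ[ℂ] H := fun α => diagonalUnitary b _ (hc α)
  have hUV : ∀ α f, U α f = V α f := fun α f =>
    (hU α f).unique (hasSum_diagonalUnitary b _ (hc α) f)
  have hVinner : ∀ α f i, inner ℂ (b i) (V α f) =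
      Complex.exp (Complex.I * (n i : ℂ) * (α : ℂ)) * inner ℂ (b i) f := fun α f i =>
    inner_diagonalUnitary b _ (hc α) f i
  have hext : ∀ f g : H, (∀ i, inner ℂ (b i) f = inner ℂ (b i) g) → f = g := fun f g h => by
    refine b.repr.injective ?_
    ext i
    rw [b.repr_apply_apply, b.repr_apply_apply, h]
  refine ⟨fun α => ?_, fun f => ?_, fun α β f => ?_, fun f => ?_⟩
  · exact ⟨_, (Unitary.linearIsometryEquiv.symm (V α)).2, fun f => hUV α f⟩
  · rw [hUV]
    exact hext _ _ fun i => by rw [hVinner]; simp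
  · rw [hUV, hUV, hUV]
    refine hext _ _ fun i => ?_
    rw [hVinner, hVinner, hVinner, ← mul_assoc, ← Complex.exp_add]
    congr 2
    push_cast
    ring
  · simp only [hUV]
    refine continuous_apply_of_hilbertBasis b V (fun i => ?_) f
    have e : ∀ α, V α (b i) = Complex.exp (Complex.I * (n i : ℂ) * (α : ℂ)) • b i := fun α => by
      classical
      refine hext _ _ fun j => ?_
      rw [hVinner, inner_smul_right, orthonormal_iff_ite.1 b.orthonormal]
      split_ifs with h
      · rw [h]
      · rw [mul_zero, mul_zero]
    simp only [e]
    fun_prop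

end Diagonal

/-! ### The fractional Dunkl transform -/

/-- The generalized Hermite functions as a Hilbert basis of `L²(ω_k dx)`. -/
noncomputable def Datum.hermiteBasis (S : Datum N) {φ : (Fin N → ℕ) → MvPolynomial (Fin N) ℝ}
    (hφ : S.IsHomogeneousOrthonormalBasis φ) : HilbertBasis (Fin N → ℕ) ℂ S.L2 :=
  HilbertBasis.mkOfOrthogonalEqBot (S.orthonormal_hermite hφ) (by
    rw [Submodule.eq_bot_iff]
    exact fun g hg => S.eq_zero_of_inner_hermite_eq_zero hφ fun ν =>
      (Submodule.mem_orthogonal _ g).1 hg _ (Submodule.subset_span ⟨ν, rfl⟩))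

theorem Datum.hermiteBasis_apply (S : Datum N) {φ : (Fin N → ℕ) → MvPolynomial (Fin N) ℝ}
    (hφ : S.IsHomogeneousOrthonormalBasis φ) (ν : Fin N → ℕ) :
    S.hermiteBasis hφ ν = S.hermite φ ν := by
  rw [hermiteBasis, HilbertBasis.coe_mkOfOrthogonalEqBot]

end Dunkl

theorem mainTheorem4 (N : ℕ) (S : Dunkl.Datum N)
    (φ : (Fin N → ℕ) → MvPolynomial (Fin N) ℝ) (hφ : S.IsHomogeneousOrthonormalBasis φ) :
    (∀ (α : ℝ) (f : S.L2), Summable (S.fracDunklTerm φ α f)) ∧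
      Dunkl.IsUnitaryC0Group (S.fracDunkl φ) := by
  have hterm : ∀ (α : ℝ) (f : S.L2), S.fracDunklTerm φ α f = fun ν =>
      (Complex.exp (Complex.I * ((∑ i, ν i : ℕ) : ℂ) * (α : ℂ)) *
        inner ℂ (S.hermiteBasis hφ ν) f) • S.hermiteBasis hφ ν := fun α f => by
    ext1 ν
    rw [S.hermiteBasis_apply, Dunkl.Datum.fracDunklTerm]
  have hsum : ∀ (α : ℝ) (f : S.L2), Summable (S.fracDunklTerm φ α f) := fun α f => by
    rw [hterm]
    refine (Dunkl.hasSum_diagonalUnitary (S.hermiteBasis hφ) _ (fun ν => ?_) f).summable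
    rw [show Complex.I * ((∑ i, ν i : ℕ) : ℂ) * (α : ℂ) =
      (((∑ i, ν i : ℕ) * α : ℝ) : ℂ) * Complex.I by push_cast; ring, Complex.norm_exp_ofReal_mul_I]
  refine ⟨hsum, Dunkl.isUnitaryC0Group_diagonal (S.hermiteBasis hφ) (fun ν => ∑ i, ν i)
    fun α f => ?_⟩
  rw [← hterm]
  exact (hsum α f).hasSum
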